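/- Let $P$ be a probability distribution on $\mathcal X\times\mathbb R$, where $\mathcal X$ is a measurable space. Let $\mathcal A$ be a regression algorithm: it maps every finite data set of points of $\mathcal X\times\mathbb R$, of any size, to a measurable function $\mathcal X\to\mathbb R$, its output does not depend on the order of the data points, and, for each sample size, the prediction at $x$ is jointly measurable in the data set and $x$. Let $n,m\ge 1$ be integers, let $\alpha\in[0,1]$, $\delta\in(0,1)$ and $\epsilon,\nu\in\mathbb R$. For real numbers $v_1,\dots,v_n$ and a level $\tau$, let $\mathrm{Quantile}(\{v_i\};\tau)=\inf\{t\in[-\infty,\infty]:\#\{i:v_i\le t\}\ge\tau n\}$. Given $\mathcal D_n=((X_1,Y_1),\dots,(X_n,Y_n))$, let $\widehat\mu_{-i}$ be the output of $\mathcal A$ on $\mathcal D_n$ with $(X_i,Y_i)$ removed and let $R_i=|Y_i-\widehat\mu_{-i}(X_i)|$. For $\gamma\in\mathbb R$, the $\gamma$-inflated jackknife+ interval at $x\in\mathcal X$ is the set of real numbers $$\widehat C_n^{\gamma\text{-J+}}(x)=\Big[-\mathrm{Quantile}\big(\{-\widehat\mu_{-i}(x)+R_i\}_{i\le n};(1-\alpha)(1+\tfrac1n)\big)-\gamma,\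 \mathrm{Quantile}\big(\{\widehat\mu_{-i}(x)+R_i\}_{i\le n};(1-\alpha)(1+\tfrac1n)\big)+\gamma\Big]\cap\mathbb R ,$$ and $\widehat C_n^{\text{J+}}=\widehat C_n^{0\text{-J+}}$. Let $\alpha_P^{\gamma\text{-J+}}(\mathcal D_n)=\mathbb P\{Y\notin\widehat C_n^{\gamma\text{-J+}}(X)\mid\mathcal D_n\}$, where $(X,Y)\sim P$ is independent of $\mathcal D_n$, and define $\alpha_P^{\text{J+}}(\mathcal D_n)$ likewise from $\widehat C_n^{\text{J+}}$. Assume that $$\mathbb P\{|\widehat\mu_{n-1}(X)-\widehat\mu_{n+m-1}(X)|\le\epsilon\}\ge 1-\nu ,$$ where $\widehat\mu_k=\mathcal A((X_1,Y_1),\dots,(X_k,Y_k))$ and $(X_1,Y_1),\dots,(X_{n+m-1},Y_{n+m-1}),(X,Y)$ are i.i.d. draws from $P$. Then, for $\mathcal D_n$ consisting of $n$ i.i.d. draws from $P$, $$\mathbb P\Big\{\alpha_P^{2\epsilon\text{-J+}}(\mathcal D_n)<\alpha+3\sqrt{\tfrac{\log(1/\delta)}{2\min\{n,m\}}}+2\sqrt[3]{2\nu}\Big\}\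 \ge\ 1-3\delta-\sqrt[3]{2\nu}.$$ Moreover, if the conditional distribution of $Y$ given $X$ (for $(X,Y)\sim P$) has a density $f_{Y|X}(y\mid x)$ with respect to Lebesgue measure, and $B_{\mathrm{dens}}=\mathbb E\big[\sup_{y\in\mathbb R}f_{Y|X}(y\mid X)\big]\in[0,\infty]$, then $$\mathbb P\Big\{\alpha_P^{\text{J+}}(\mathcal D_n)<\alpha+3\sqrt{\tfrac{\log(1/\delta)}{2\min\{n,m\}}}+2\sqrt[3]{2\nu}+4B_{\mathrm{dens}}\,\epsilon\Big\}\ \ge\ 1-3\delta-\sqrt[3]{2\nu},$$ with the convention $\infty\cdot 0=0$. -/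

import Mathlib

open MeasureTheory ProbabilityTheory
open scoped ENNReal

noncomputable section

/-- A symmetric regression algorithm: for every sample size `n ≥ 0` it maps a training set of `n`
points of `𝒳 × ℝ` to a fitted regression function `𝒳 → ℝ`, and it does not depend on the order of
the training points. Measurability is required jointly in the training set and the feature, so that
probabilities over the training data make sense; in particular, every fitted function is
measurable. -/
structure RegressionAlgorithm (𝒳 : Type*) [MeasurableSpace 𝒳] where
  fit : (n : ℕ) → (Fin n → 𝒳 × ℝ) → 𝒳 → ℝ
  measurable_fit : ∀ n : ℕ,
    Measurable (fun p : (Fin n → 𝒳 × ℝ) × 𝒳 => fit n p.1 p.2)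
  symmetric_fit : ∀ (n : ℕ) (π : Equiv.Perm (Fin n)) (D : Fin n → 𝒳 × ℝ),
    fit n (D ∘ π) = fit n D

/-- The training set `D` with its `i`-th point removed. -/
def leaveOneOut {Z : Type*} {n : ℕ} (D : Fin n → Z) (i : Fin n) : Fin (n - 1) → Z :=
  fun j => D ⟨if j.1 < i.1 then j.1 else j.1 + 1, by have := j.2; split_ifs <;> omega⟩

/-- `Quantile({v i}; τ)`: the smallest `t` such that at least a fraction `τ` of the values `v i` is
at most `t`. It is `+∞` for `τ > 1` and `-∞` for `τ ≤ 0`. -/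
def empQuantile {n : ℕ} (v : Fin n → ℝ) (τ : ℝ) : EReal :=
  sInf {t : EReal | τ * (n : ℝ) ≤ ((Finset.univ.filter fun i => (v i : EReal) ≤ t).card : ℝ)}

section JackknifePlus

variable {𝒳 : Type*} [MeasurableSpace 𝒳] (A : RegressionAlgorithm 𝒳) {n : ℕ}

/-- The leave-one-out model, fitted to the training set without its `i`-th point. -/
def looModel (D : Fin n → 𝒳 × ℝ) (i : Fin n) : 𝒳 → ℝ :=
  A.fit (n - 1) (leaveOneOut D i)

/-- The leave-one-out residual `R_i = |Y_i - μ̂_{-i}(X_i)|`. -/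
def looResidual (D : Fin n → 𝒳 × ℝ) (i : Fin n) : ℝ :=
  |(D i).2 - looModel A D i (D i).1|

/-- The lower endpoint of the jackknife+ interval at the test feature `x`. -/
def jackLower (α : ℝ) (D : Fin n → 𝒳 × ℝ) (x : 𝒳) : EReal :=
  -empQuantile (fun i => -looModel A D i x + looResidual A D i) ((1 - α) * (1 + 1 / (n : ℝ)))

/-- The upper endpoint of the jackknife+ interval at the test feature `x`. -/
def jackUpper (α : ℝ) (D : Fin n → 𝒳 × ℝ) (x : 𝒳) : EReal :=
  empQuantile (fun i => looModel A D i x + looResidual A D i) ((1 - α) * (1 + 1 / (n : ℝ)))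

/-- The jackknife+ prediction interval at the test feature `x`. -/
def jackInterval (α : ℝ) (D : Fin n → 𝒳 × ℝ) (x : 𝒳) : Set ℝ :=
  {y : ℝ | jackLower A α D x ≤ (y : EReal) ∧ (y : EReal) ≤ jackUpper A α D x}

/-- The `γ`-inflated jackknife+ prediction interval at the test feature `x`. -/
def inflatedJackInterval (α γ : ℝ) (D : Fin n → 𝒳 × ℝ) (x : 𝒳) : Set ℝ :=
  {y : ℝ | jackLower A α D x - (γ : EReal) ≤ (y : EReal) ∧
    (y : EReal) ≤ jackUpper A α D x + (γ : EReal)}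

end JackknifePlus

section Probability

variable {𝒳 : Type*} [MeasurableSpace 𝒳]

/-- The probability that a prediction band `C` fails to cover a new point `(X, Y) ∼ P`. For a band
`C` built from a training set `D`, this is the training-conditional miscoverage rate given `D`. -/
def miscoverage (P : Measure (𝒳 × ℝ)) (C : 𝒳 → Set ℝ) : ℝ≥0∞ :=
  P {z | z.2 ∉ C z.1}

/-- The law of `n` i.i.d. draws from `P`. -/
def iidLaw (P : Measure (𝒳 × ℝ)) (n : ℕ) : Measure (Fin n → 𝒳 × ℝ) :=
  Measure.pi fun _ => P

/-- `ℙ{|μ̂_k(X) - μ̂_{k+m}(X)| ≤ ε}`, where `μ̂_{k+m}` is fitted to `k + m` training points, `μ̂_k` to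
the first `k` of them, and the training points and `(X, Y)` are i.i.d. draws from `P`. -/
def stabilityProb (A : RegressionAlgorithm 𝒳) (P : Measure (𝒳 × ℝ)) (k m : ℕ) (ε : ℝ) : ℝ≥0∞ :=
  ((iidLaw P (k + m)).prod P)
    {w | |A.fit k (fun i => w.1 (Fin.castAdd m i)) w.2.1 - A.fit (k + m) w.1 w.2.1| ≤ ε}

/-- `f x y` is a density, with respect to Lebesgue measure, of the conditional distribution of `Y`
given `X = x`, for `(X, Y) ∼ P`. -/
def IsCondDensity (P : Measure (𝒳 × ℝ)) [IsProbabilityMeasure P] (f : 𝒳 → ℝ → ℝ≥0∞) : Prop :=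
  Measurable (fun z : 𝒳 × ℝ => f z.1 z.2) ∧
    ∀ᵐ x ∂P.fst, P.condKernel x = (volume : Measure ℝ).withDensity (f x)

/-- `B_dens = 𝔼[sup_y f(y ∣ X)]`, a number in `[0, ∞]`. -/
def densBound (P : Measure (𝒳 × ℝ)) (f : 𝒳 → ℝ → ℝ≥0∞) : ℝ≥0∞ :=
  ∫⁻ x, ⨆ y : ℝ, f x y ∂P.fst

end Probability

end

/-! Add `m` fresh points to the `n` training points and let `R a` be the residual at `a` of the
model fitted to all `n + m - 1` other points. By symmetry of the algorithm, `R` is equivariant under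
permutations of the i.i.d. points, so a set defined by the ranks of `R` meets the training block or
the fresh block like a sample without replacement. Hoeffding's inequality for such samples
(`measure_equivariant_deviation_le`) then shows that few fresh points `j` have an `R j` above almost
all training `R i`.

Stability ties these residuals to the jackknife+. The model without `i` is compared with the model
omitting `i` and with the model omitting `j`; with `κ = (2ν)^(1/3)`, either comparison fails with
probability at most `2ν = κ³`. By Markov, more than `κ² n m` pairs fail with probability at most
`κ`; otherwise at most `κ m` fresh points have more than `κ n` bad partners. For a good pair, an
error at `j` exceeding the leave-one-out residual of `i` by more than `2ε` forces `R i < R j`.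
Miscoverage of `j` demands such an excess for at least `(1 - α)(n + 1)` indices `i`, so
`card_exceed_lt` bounds the fraction of such `j` by `α + 2κ + 2s`.

Hoeffding's inequality for the fresh points, given the training set, turns this fraction into the
conditional probability at the price of another `s`. Three deviation events of probability at most
`δ` and the Markov event of probability at most `κ` make up the failure probability.

For the uninflated interval, inflation by `2ε` adds two strips of total length at most `4ε`, whose
probability is controlled by the supremum of the conditional density. -/

theorem measurableSet_setOf_finite_pattern {Ω ι : Type*} [MeasurableSpace Ω] [Finite ι]
    {p : ι → Ω → Prop} (hp : ∀ i, MeasurableSet {ω | p i ω}) (T : (ι → Prop) → Prop) :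
    MeasurableSet {ω | T fun i => p i ω} := by
  have hf : Measurable fun ω => fun i => p i ω :=
    measurable_pi_iff.2 fun i => measurableSet_setOfPred.1 (hp i)
  -- The space of patterns `ι → Prop` is finite and discrete, so any condition on counts of indices
  -- is measurable.
  exact hf (MeasurableSet.of_discrete (s := {q : ι → Prop | T q}))

/-! ### Exponential moments of Bernoulli variables -/

/-- Hoeffding's lemma for the Bernoulli law `μ`, multiplied by `exp (t * p)` to undo the centring.
-/
theorem one_add_mul_exp_sub_one_le {p : ℝ} (hp0 : 0 ≤ p) (hp1 : p ≤ 1) (t : ℝ) :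
    1 + p * (Real.exp t - 1) ≤ Real.exp (t * p + t ^ 2 / 8) := by
  let μ : Measure ℝ := ENNReal.ofReal (1 - p) • Measure.dirac 0 + ENNReal.ofReal p • Measure.dirac 1
  have hμ : IsProbabilityMeasure μ := ⟨by
    simp only [μ, Measure.add_apply, Measure.smul_apply, measure_univ, smul_eq_mul, mul_one]
    rw [← ENNReal.ofReal_add (by linarith) hp0]; simp⟩
  have hint : ∀ g : ℝ → ℝ, ∫ x, g x ∂μ = (1 - p) * g 0 + p * g 1 := by
    intro g
    have h : ∀ (c : ℝ) (a : ℝ), Integrable g (ENNReal.ofReal c • Measure.dirac a) := fun c a =>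
      (integrable_dirac (by simp)).smul_measure ENNReal.ofReal_ne_top
    rw [integral_add_measure (h _ _) (h _ _), integral_smul_measure, integral_smul_measure,
      integral_dirac, integral_dirac, ENNReal.toReal_ofReal (by linarith), ENNReal.toReal_ofReal hp0]
    simp
  have hae : ∀ᵐ x ∂μ, id x ∈ Set.Icc (0 : ℝ) 1 := by
    rw [ae_add_measure_iff]
    constructor <;> refine Measure.ae_smul_measure ?_ _ <;>
      exact (ae_dirac_iff measurableSet_Icc).2 (by simp)
  have h := (hasSubgaussianMGF_of_mem_Icc (μ := μ) (X := id) aemeasurable_id hae).mgf_le t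
  rw [mgf, hint, hint] at h
  have h2 : (1 - p) * Real.exp (t * (0 - p)) + p * Real.exp (t * (1 - p)) ≤
      Real.exp (t ^ 2 / 8) := by
    refine le_trans (le_of_eq ?_) (h.trans (Real.exp_le_exp.2 (le_of_eq ?_)))
    · simp
    · push_cast; simp; ring
  calc 1 + p * (Real.exp t - 1)
      = Real.exp (t * p) * ((1 - p) * Real.exp (t * (0 - p)) + p * Real.exp (t * (1 - p))) := by
        have e1 : Real.exp (t * p) * Real.exp (t * (0 - p)) = 1 := by
          rw [← Real.exp_add]; ring_nf; exact Real.exp_zero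
        have e2 : Real.exp (t * p) * Real.exp (t * (1 - p)) = Real.exp t := by
          rw [← Real.exp_add]; ring_nf
        linear_combination -(1 - p) * e1 - p * e2
    _ ≤ Real.exp (t * p) * Real.exp (t ^ 2 / 8) := by gcongr
    _ = _ := by rw [← Real.exp_add]

/-- The Chernoff bound at the optimal parameter `4 s`. -/
theorem chernoff_factor_le {p : ℝ} (hp0 : 0 ≤ p) (hp1 : p ≤ 1) (M : ℕ) (s : ℝ) :
    (1 + p * (Real.exp (4 * s) - 1)) ^ M ≤
      Real.exp (-2 * M * s ^ 2) * Real.exp (4 * s * (M * p + M * s)) := by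
  have h0 : 0 ≤ 1 + p * (Real.exp (4 * s) - 1) := by
    nlinarith [Real.exp_pos (4 * s), mul_nonneg hp0 (Real.exp_pos (4 * s)).le]
  calc (1 + p * (Real.exp (4 * s) - 1)) ^ M
      ≤ (Real.exp (4 * s * p + (4 * s) ^ 2 / 8)) ^ M :=
        pow_le_pow_left₀ h0 (one_add_mul_exp_sub_one_le hp0 hp1 _) _
    _ = _ := by rw [← Real.exp_nat_mul, ← Real.exp_add]; congr 1; ring

theorem prod_one_add_ite {ι : Type*} (M : Finset ι) (q : ι → Prop) [DecidablePred q] (t : ℝ) :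
    ∏ j ∈ M, (1 + (Real.exp t - 1) * if q j then 1 else 0) =
      Real.exp (t * (M.filter q).card) := by
  have : ∀ j ∈ M, (1 + (Real.exp t - 1) * if q j then 1 else 0) =
      if q j then Real.exp t else 1 := by intro j _; split_ifs <;> ring
  rw [Finset.prod_congr rfl this, Finset.prod_ite]
  simp [← Real.exp_nat_mul, mul_comm]

/-! ### Sampling without replacement -/

section Permutations

variable {ι : Type*} [Fintype ι] [DecidableEq ι]

/-- By symmetry every `b ∉ S` could replace `a`. Double counting pairs `(π, b)` gives `|Sᶜ| c = |F|
(|G| - |S|)`, and `c ≤ |F|` then yields the bound. -/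
theorem card_perm_mapsTo_insert_mul_le (G S : Finset ι) (a : ι) (ha : a ∉ S) :
    (Finset.univ.filter fun π : Equiv.Perm ι => ∀ b ∈ insert a S, π b ∈ G).card * Fintype.card ι ≤
      (Finset.univ.filter fun π : Equiv.Perm ι => ∀ b ∈ S, π b ∈ G).card * G.card := by
  set F := Finset.univ.filter fun π : Equiv.Perm ι => ∀ b ∈ S, π b ∈ G
  set c := (Finset.univ.filter fun π : Equiv.Perm ι => ∀ b ∈ insert a S, π b ∈ G).card
  -- Composing with the transposition of `a` and `b` exchanges their conditions and leaves those on
  -- `S` intact.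
  have hsymm : ∀ b ∈ Sᶜ, (F.filter fun π => π b ∈ G).card = c := by
    intro b hb
    refine Finset.card_bij' (fun π _ => π * Equiv.swap a b) (fun π _ => π * Equiv.swap a b)
      ?_ ?_ ?_ ?_
    · intro π hπ
      simp only [F, Finset.mem_filter, Finset.mem_univ, true_and, Finset.mem_insert] at hπ ⊢
      rintro d (rfl | hd)
      · simpa using hπ.2
      · have h1 : d ≠ a := fun h => ha (h ▸ hd)
        have h2 : d ≠ b := fun h => (Finset.mem_compl.1 hb) (h ▸ hd)
        simpa [Equiv.swap_apply_of_ne_of_ne h1 h2] using hπ.1 d hd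
    · intro π hπ
      simp only [F, Finset.mem_filter, Finset.mem_univ, true_and, Finset.mem_insert] at hπ ⊢
      refine ⟨fun d hd => ?_, by simpa using hπ a (Or.inl rfl)⟩
      have h1 : d ≠ a := fun h => ha (h ▸ hd)
      have h2 : d ≠ b := fun h => (Finset.mem_compl.1 hb) (h ▸ hd)
      simpa [Equiv.swap_apply_of_ne_of_ne h1 h2] using hπ d (Or.inr hd)
    · intro π _; simp [mul_assoc]
    · intro π _; simp [mul_assoc]
  have hfib : ∀ π ∈ F, (Sᶜ.filter fun b => π b ∈ G).card + S.card = G.card := by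
    intro π hπ
    simp only [F, Finset.mem_filter, Finset.mem_univ, true_and] at hπ
    rw [← Finset.card_map π.toEmbedding (s := Sᶜ.filter fun b => π b ∈ G),
      ← Finset.card_map π.toEmbedding (s := S), ← Finset.card_union_of_disjoint]
    · congr 1
      ext g
      simp only [Finset.mem_union, Finset.mem_map, Finset.mem_filter, Finset.mem_compl,
        Equiv.coe_toEmbedding]
      constructor
      · rintro (⟨b, hb, rfl⟩ | ⟨b, hb, rfl⟩)
        · exact hb.2
        · exact hπ b hb
      · intro hg
        by_cases h : π.symm g ∈ S
        · exact Or.inr ⟨_, h, by simp⟩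
        · exact Or.inl ⟨_, ⟨h, by simpa using hg⟩, by simp⟩
    · rw [Finset.disjoint_map]
      exact Finset.disjoint_left.2 fun b hb => Finset.mem_compl.1 (Finset.mem_filter.1 hb).1
  have hdouble : Sᶜ.card * c + F.card * S.card = F.card * G.card := by
    have h1 : ∑ b ∈ Sᶜ, (F.filter fun π => π b ∈ G).card =
        ∑ π ∈ F, (Sᶜ.filter fun b => π b ∈ G).card :=
      Finset.sum_card_bipartiteAbove_eq_sum_card_bipartiteBelow
        (fun b (π : Equiv.Perm ι) => π b ∈ G)
    rw [Finset.sum_congr rfl hsymm, Finset.sum_const, smul_eq_mul] at h1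
    rw [h1, ← smul_eq_mul F.card S.card, ← Finset.sum_const, ← Finset.sum_add_distrib,
      Finset.sum_congr rfl hfib, Finset.sum_const, smul_eq_mul]
  have hcF : c ≤ F.card := by
    refine Finset.card_le_card fun π hπ => ?_
    simp only [F, Finset.mem_filter, Finset.mem_univ, true_and, Finset.mem_insert] at hπ ⊢
    exact fun b hb => hπ b (Or.inr hb)
  have hS : Sᶜ.card + S.card = Fintype.card ι := by
    rw [add_comm]; exact Finset.card_add_card_compl S
  rw [← hS, ← hdouble]
  nlinarith

theorem card_perm_mapsTo_mul_le (G S : Finset ι) :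
    (Finset.univ.filter fun π : Equiv.Perm ι => ∀ b ∈ S, π b ∈ G).card *
      Fintype.card ι ^ S.card ≤ (Fintype.card ι).factorial * G.card ^ S.card := by
  induction S using Finset.induction_on with
  | empty => simp [Fintype.card_perm]
  | insert a S ha ih =>
    rw [Finset.card_insert_of_notMem ha, pow_succ, pow_succ]
    have h := card_perm_mapsTo_insert_mul_le G S a ha
    calc _ = _ * Fintype.card ι * Fintype.card ι ^ S.card := by ring
      _ ≤ _ * G.card * Fintype.card ι ^ S.card := Nat.mul_le_mul_right _ h
      _ = _ * Fintype.card ι ^ S.card * G.card := by ring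
      _ ≤ _ := by rw [← mul_assoc]; exact Nat.mul_le_mul_right _ ih

/-- The exponential moment without replacement is at most the binomial one: expand over subsets `S`
of `M`, whose coefficients `c ^ |S|` are nonnegative, and use that `S` lands in `G` for at most a
fraction `(|G| / N) ^ |S|` of the permutations. -/
theorem sum_perm_prod_one_add_le (G M : Finset ι) {c : ℝ} (hc : 0 ≤ c) :
    ∑ π : Equiv.Perm ι, ∏ j ∈ M, (1 + c * if π j ∈ G then 1 else 0) ≤
      (Fintype.card ι).factorial * (1 + (G.card / Fintype.card ι : ℝ) * c) ^ M.card := by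
  rcases isEmpty_or_nonempty ι with h | h
  · simp [Finset.eq_empty_of_isEmpty M]
  have hN : (0 : ℝ) < Fintype.card ι := by exact_mod_cast Fintype.card_pos
  have hexp : ∀ π : Equiv.Perm ι, ∏ j ∈ M, (1 + c * if π j ∈ G then 1 else 0) =
      ∑ S ∈ M.powerset, c ^ S.card * if ∀ b ∈ S, π b ∈ G then 1 else 0 := by
    intro π
    rw [Finset.prod_one_add]
    refine Finset.sum_congr rfl fun S _ => ?_
    rw [Finset.prod_mul_distrib, Finset.prod_const]
    congr 1
    rw [Finset.prod_ite_zero]; simp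
  simp_rw [hexp]
  rw [Finset.sum_comm]
  have hR : (1 + (G.card / Fintype.card ι : ℝ) * c) ^ M.card =
      ∑ S ∈ M.powerset, ((G.card / Fintype.card ι : ℝ) * c) ^ S.card := by
    rw [← Finset.prod_const, Finset.prod_one_add]
    simp
  rw [hR, Finset.mul_sum]
  refine Finset.sum_le_sum fun S _ => ?_
  rw [← Finset.mul_sum, Finset.sum_boole]
  have h : ((Finset.univ.filter fun π : Equiv.Perm ι => ∀ b ∈ S, π b ∈ G).card : ℝ) *
      (Fintype.card ι : ℝ) ^ S.card ≤ (Fintype.card ι).factorial * (G.card : ℝ) ^ S.card := by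
    exact_mod_cast card_perm_mapsTo_mul_le G S
  rw [← le_div_iff₀ (by positivity)] at h
  calc _ ≤ c ^ S.card * (_ / _) := by gcongr
    _ = _ := by rw [mul_pow, div_pow]; ring

/-- Hoeffding's inequality for sampling without replacement, in counting form. -/
theorem card_perm_deviation_le (G M : Finset ι) {s : ℝ} (hs : 0 ≤ s) :
    ((Finset.univ.filter fun π : Equiv.Perm ι =>
      (M.card : ℝ) * (G.card / Fintype.card ι) + M.card * s ≤
        (M.filter fun j => π j ∈ G).card).card : ℝ) ≤
      (Fintype.card ι).factorial * Real.exp (-2 * M.card * s ^ 2) := by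
  set p : ℝ := G.card / Fintype.card ι
  have hp0 : 0 ≤ p := by positivity
  have hp1 : p ≤ 1 := div_le_one_of_le₀ (by exact_mod_cast Finset.card_le_univ G) (by positivity)
  set B := Real.exp (4 * s * (M.card * p + M.card * s))
  have hB : 0 < B := Real.exp_pos _
  have hc : 0 ≤ Real.exp (4 * s) - 1 := by
    linarith [Real.one_le_exp (show 0 ≤ 4 * s by positivity)]
  -- Markov's inequality: each counted permutation contributes at least `B` to the exponential
  -- moment.
  refine le_of_mul_le_mul_right ?_ hB
  calc _ = ∑ π ∈ Finset.univ.filter fun π : Equiv.Perm ι =>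
        (M.card : ℝ) * p + M.card * s ≤ (M.filter fun j => π j ∈ G).card, B := by
        rw [Finset.sum_const, nsmul_eq_mul]
    _ ≤ ∑ π ∈ Finset.univ.filter fun π : Equiv.Perm ι =>
        (M.card : ℝ) * p + M.card * s ≤ (M.filter fun j => π j ∈ G).card,
        ∏ j ∈ M, (1 + (Real.exp (4 * s) - 1) * if π j ∈ G then 1 else 0) := by
        refine Finset.sum_le_sum fun π hπ => ?_
        rw [prod_one_add_ite]
        refine Real.exp_le_exp.2 ?_
        have := (Finset.mem_filter.1 hπ).2
        gcongr
    _ ≤ ∑ π : Equiv.Perm ι, ∏ j ∈ M, (1 + (Real.exp (4 * s) - 1) * if π j ∈ G then 1 else 0) :=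
        Finset.sum_le_sum_of_subset_of_nonneg (Finset.filter_subset _ _) fun π _ _ =>
          Finset.prod_nonneg fun j _ => by split_ifs <;> linarith
    _ ≤ _ := sum_perm_prod_one_add_le G M hc
    _ ≤ _ := by
        rw [mul_assoc]
        exact mul_le_mul_of_nonneg_left (chernoff_factor_le hp0 hp1 _ _) (by positivity)

end Permutations

/-! ### Concentration for i.i.d. points -/

section ProductMeasures

variable {Z ι κ : Type*} [MeasurableSpace Z] [Fintype ι] [Fintype κ]

/-- Distinct coordinates of an i.i.d. family are again i.i.d.; unselected coordinates contribute
factors `P univ = 1`. This covers permutations, reindexing and marginals alike. -/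
theorem measurePreserving_comp_of_injective (P : Measure Z) [IsProbabilityMeasure P]
    {g : κ → ι} (hg : Function.Injective g) :
    MeasurePreserving (fun D : ι → Z => D ∘ g) (Measure.pi fun _ => P) (Measure.pi fun _ => P) := by
  have hm : Measurable fun D : ι → Z => D ∘ g :=
    measurable_pi_iff.2 fun i => measurable_pi_apply (g i)
  refine ⟨hm, (Measure.pi_eq fun s hs => ?_).symm⟩
  rw [Measure.map_apply hm (MeasurableSet.univ_pi hs)]
  have : (fun D : ι → Z => D ∘ g) ⁻¹' Set.univ.pi s =
      Set.univ.pi (Function.extend g s fun _ => Set.univ) := by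
    ext D
    simp only [Set.mem_preimage, Set.mem_pi, Set.mem_univ, true_implies, Function.comp_apply]
    constructor
    · intro h j
      by_cases hj : ∃ i, g i = j
      · obtain ⟨i, rfl⟩ := hj
        rw [hg.extend_apply]; exact h i
      · rw [Function.extend_apply' _ _ _ hj]; trivial
    · intro h i
      have := h (g i)
      rwa [hg.extend_apply] at this
  rw [this, Measure.pi_pi]
  refine (Fintype.prod_of_injective g hg _ _ (fun j hj => ?_) fun i => ?_).symm
  · rw [Function.extend_apply' _ _ _ (by simpa using hj)]; simp
  · rw [hg.extend_apply]

/-- **Hoeffding's inequality** for the number of i.i.d. points that fall into a set. -/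
theorem measure_card_deviation_le (P : Measure Z) [IsProbabilityMeasure P] {F : Set Z}
    (hF : MeasurableSet F) [DecidablePred (· ∈ F)] (hι : 0 < Fintype.card ι)
    {s : ℝ} (hs : 0 ≤ s) :
    (Measure.pi fun _ : ι => P) {z | (Fintype.card ι : ℝ) * P.real F + Fintype.card ι * s ≤
      (Finset.univ.filter fun j => z j ∈ F).card} ≤
      ENNReal.ofReal (Real.exp (-2 * Fintype.card ι * s ^ 2)) := by
  set Q := Measure.pi fun _ : ι => P
  have hcard : (0 : ℝ) < Fintype.card ι := by exact_mod_cast hι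
  have hFm : Measurable (F.indicator fun _ => (1 : ℝ)) := measurable_const.indicator hF
  have hindep : iIndepFun (fun (j : ι) (z : ι → Z) => F.indicator (fun _ => (1 : ℝ)) (z j) - P.real F) Q :=
    iIndepFun_pi (X := fun _ z => F.indicator (fun _ => (1 : ℝ)) z - P.real F)
      fun _ => (hFm.sub_const _).aemeasurable
  have hsub : ∀ j ∈ (Finset.univ : Finset ι), HasSubgaussianMGF
      (fun z : ι → Z => F.indicator (fun _ => (1 : ℝ)) (z j) - P.real F)
      ((‖(1 : ℝ) - 0‖₊ / 2) ^ 2) Q := by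
    intro j _
    have hint : ∫ z : ι → Z, F.indicator (fun _ => (1 : ℝ)) (z j) ∂Q = P.real F := by
      have h := (measurePreserving_eval (fun _ : ι => P) j).map_eq
      rw [← integral_indicator_one hF]
      conv_rhs => rw [← h]
      rw [integral_map (measurable_pi_apply j).aemeasurable]
      · rfl
      · exact hFm.aestronglyMeasurable
    rw [← hint]
    refine hasSubgaussianMGF_of_mem_Icc (hFm.comp (measurable_pi_apply j)).aemeasurable
      (Filter.Eventually.of_forall fun z => ?_)
    by_cases h : z j ∈ F <;> simp [h]
  have h := HasSubgaussianMGF.measure_sum_ge_le_of_iIndepFun hindep hsub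
    (show 0 ≤ (Fintype.card ι : ℝ) * s by positivity)
  have hset : {z : ι → Z | (Fintype.card ι : ℝ) * P.real F + Fintype.card ι * s ≤
      (Finset.univ.filter fun j => z j ∈ F).card} = {z | (Fintype.card ι : ℝ) * s ≤
      ∑ j, (F.indicator (fun _ => (1 : ℝ)) (z j) - P.real F)} := by
    ext z
    simp only [Set.mem_ofPred_eq, Finset.sum_sub_distrib, Finset.sum_const, Finset.card_univ,
      nsmul_eq_mul, Set.indicator_apply, Finset.sum_boole]
    constructor <;> intro h <;> linarith
  rw [hset, ← ofReal_measureReal]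
  refine ENNReal.ofReal_le_ofReal (h.trans (Real.exp_le_exp.2 (le_of_eq ?_)))
  simp
  field_simp

/-- Hoeffding's inequality for sampling without replacement: a random set `G` that is equivariant
under permutations of i.i.d. points is not over-represented in a fixed set `M` of indices. -/
theorem measure_equivariant_deviation_le [DecidableEq ι] (P : Measure Z) [IsProbabilityMeasure P]
    (G : (ι → Z) → Finset ι) (hGm : ∀ a, MeasurableSet {D | a ∈ G D})
    (hGe : ∀ (π : Equiv.Perm ι) (D : ι → Z) (a : ι), a ∈ G (D ∘ π) ↔ π a ∈ G D)
    (M : Finset ι) {s : ℝ} (hs : 0 ≤ s) :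
    (Measure.pi fun _ : ι => P) {D | (M.card : ℝ) * ((G D).card / Fintype.card ι) + M.card * s ≤
      (M ∩ G D).card} ≤ ENNReal.ofReal (Real.exp (-2 * M.card * s ^ 2)) := by
  classical
  set Q := Measure.pi fun _ : ι => P
  set B := {D : ι → Z | (M.card : ℝ) * ((G D).card / Fintype.card ι) + M.card * s ≤
      (M ∩ G D).card}
  set e := Real.exp (-2 * M.card * s ^ 2)
  have hB : MeasurableSet B := by
    have h := measurableSet_setOf_finite_pattern hGm
      (fun q => (M.card : ℝ) * ((Finset.univ.filter q).card / Fintype.card ι) + M.card * s ≤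
      (M ∩ Finset.univ.filter q).card)
    convert h using 3 with D; simp
  -- Exchangeability lets `Q B` be averaged over all permutations; for each fixed `D` the average is
  -- then a pure counting problem.
  have hinv : ∀ π : Equiv.Perm ι, Q B = ∫⁻ D, B.indicator 1 (D ∘ π) ∂Q := by
    intro π
    have hp := measurePreserving_comp_of_injective P π.injective
    rw [← lintegral_indicator_one hB, ← hp.lintegral_comp (measurable_one.indicator hB)]
  have hpt : ∀ D : ι → Z, ∑ π : Equiv.Perm ι, B.indicator (1 : (ι → Z) → ℝ≥0∞) (D ∘ π) ≤
      (Fintype.card ι).factorial * ENNReal.ofReal e := by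
    intro D
    have hmem : ∀ π : Equiv.Perm ι, D ∘ π ∈ B ↔ (M.card : ℝ) * ((G D).card / Fintype.card ι) +
        M.card * s ≤ (M.filter fun j => π j ∈ G D).card := by
      intro π
      have h1 : (G (D ∘ π)).card = (G D).card :=
        Finset.card_bij' (fun a _ => π a) (fun a _ => π.symm a)
          (fun a ha => (hGe π D a).1 ha)
          (fun a ha => (hGe π D _).2 (by simpa using ha)) (by simp) (by simp)
      have h2 : M ∩ G (D ∘ π) = M.filter fun j => π j ∈ G D := by
        ext a; simp [hGe]
      simp only [B, Set.mem_ofPred_eq, h1, h2]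
    have h := card_perm_deviation_le (G D) M hs
    simp_rw [Set.indicator_apply, hmem, Pi.one_apply, Finset.sum_boole]
    rw [← ENNReal.ofReal_natCast, ← ENNReal.ofReal_natCast, ← ENNReal.ofReal_mul (by positivity)]
    exact ENNReal.ofReal_le_ofReal h
  have hsum : ((Fintype.card ι).factorial : ℝ≥0∞) * Q B ≤
      (Fintype.card ι).factorial * ENNReal.ofReal e := by
    calc ((Fintype.card ι).factorial : ℝ≥0∞) * Q B = ∑ _π : Equiv.Perm ι, Q B := by
          rw [Finset.sum_const, Finset.card_univ, Fintype.card_perm, nsmul_eq_mul]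
      _ = ∑ π : Equiv.Perm ι, ∫⁻ D, B.indicator 1 (D ∘ π) ∂Q :=
          Finset.sum_congr rfl fun π _ => hinv π
      _ = ∫⁻ D, ∑ π : Equiv.Perm ι, B.indicator 1 (D ∘ π) ∂Q := by
          rw [lintegral_finsetSum]
          exact fun π _ => (measurable_one.indicator hB).comp
            (measurePreserving_comp_of_injective P π.injective).measurable
      _ ≤ ∫⁻ _D, (Fintype.card ι).factorial * ENNReal.ofReal e ∂Q := lintegral_mono hpt
      _ = _ := by simp
  exact (ENNReal.mul_le_mul_iff_right (by simp [Nat.factorial_ne_zero]) (by simp)).1 hsum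

end ProductMeasures

/-! ### Sets of high and low rank -/

section RankSets

variable {ι : Type*} [Fintype ι]

/-- The indices `b` such that at most `t` of the values are at least `R b`. -/
noncomputable def strictTop (R : ι → ℝ) (t : ℝ) : Finset ι :=
  Finset.univ.filter fun b => ((Finset.univ.filter fun c => R b ≤ R c).card : ℝ) ≤ t

/-- The indices `b` such that more than `t` of the values are greater than `R b`. -/
noncomputable def weakBottom (R : ι → ℝ) (t : ℝ) : Finset ι :=
  Finset.univ.filter fun b => t < ((Finset.univ.filter fun c => R b < R c).card : ℝ)

/-- All members lie at or above the member with the smallest value, and at most `t` indices do. -/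
theorem card_strictTop_le (R : ι → ℝ) {t : ℝ} (ht : 0 ≤ t) : ((strictTop R t).card : ℝ) ≤ t := by
  rcases (strictTop R t).eq_empty_or_nonempty with h | h
  · simpa [h] using ht
  · obtain ⟨b, hb, hmin⟩ := Finset.exists_min_image _ R h
    refine le_trans ?_ (Finset.mem_filter.1 hb).2
    exact_mod_cast Finset.card_le_card fun c hc => Finset.mem_filter.2 ⟨Finset.mem_univ _, hmin c hc⟩

theorem card_weakBottom_le (R : ι → ℝ) {t : ℝ} (ht : t ≤ Fintype.card ι) :
    ((weakBottom R t).card : ℝ) ≤ Fintype.card ι - t := by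
  classical
  rcases (weakBottom R t).eq_empty_or_nonempty with h | h
  · simpa [h] using ht
  · obtain ⟨b, hb, hmax⟩ := Finset.exists_max_image _ R h
    have h1 : (weakBottom R t) ⊆ (Finset.univ.filter fun c => R b < R c)ᶜ := fun c hc => by
      simpa using hmax c hc
    have h2 := Finset.card_le_card h1
    have h3 := Finset.card_add_card_compl (Finset.univ.filter fun c => R b < R c)
    have h4 := (Finset.mem_filter.1 hb).2
    have h5 : ((weakBottom R t).card : ℝ) + (Finset.univ.filter fun c => R b < R c).card ≤
        Fintype.card ι := by exact_mod_cast (by omega)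
    linarith

theorem mem_strictTop_of_le {R : ι → ℝ} {t : ℝ} {b c : ι} (hb : b ∈ strictTop R t)
    (h : R b ≤ R c) : c ∈ strictTop R t := by
  refine Finset.mem_filter.2 ⟨Finset.mem_univ _, le_trans ?_ (Finset.mem_filter.1 hb).2⟩
  exact_mod_cast Finset.card_le_card (Finset.monotone_filter_right _ fun d _ hd => h.trans hd)

/-- Counting with `≤` in one set and `<` in the other makes this dichotomy hold without breaking
ties. -/
theorem mem_weakBottom_of_lt {R : ι → ℝ} {t : ℝ} {b c : ι} (hb : b ∉ strictTop R t)
    (h : R c < R b) : c ∈ weakBottom R t := by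
  have hb' : t < ((Finset.univ.filter fun c => R b ≤ R c).card : ℝ) := by
    simpa [strictTop] using hb
  refine Finset.mem_filter.2 ⟨Finset.mem_univ _, hb'.trans_le ?_⟩
  exact_mod_cast Finset.card_le_card (Finset.monotone_filter_right _ fun d _ hd => h.trans_le hd)

end RankSets

/-! ### Deterministic counting of miscovered points -/

section Counting

variable {n m : ℕ}

/-- Look at the `j` in `J` with the smallest residual. If it is in the top set, so is all of `J`,
and the top set holds fewer than `m (a + s) + m s` fresh indices. If not, the at least `(1 - a) n`
training indices strictly below it are in the bottom set, which holds fewer than `n (1 - a - s) + n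
s` of them. -/
theorem card_lt_of_few_larger (hn : 0 < n) (hm : 0 < m) (R : Fin n ⊕ Fin m → ℝ) {a s : ℝ}
    (ha : 0 ≤ a) (hs : 0 < s) (has : a + s ≤ 1)
    (htop : ((Finset.univ.map Function.Embedding.inr ∩ strictTop R ((a + s) * (n + m))).card : ℝ) <
      m * ((strictTop R ((a + s) * (n + m))).card / (n + m)) + m * s)
    (hbot : ((Finset.univ.map Function.Embedding.inl ∩ weakBottom R ((a + s) * (n + m))).card : ℝ) <
      n * ((weakBottom R ((a + s) * (n + m))).card / (n + m)) + n * s)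
    (J : Finset (Fin m))
    (hJ : ∀ j ∈ J, ((Finset.univ.filter fun i : Fin n => R (.inr j) ≤ R (.inl i)).card : ℝ) ≤ a * n) :
    (J.card : ℝ) < m * (a + 2 * s) := by
  have hn' : (0 : ℝ) < n := by exact_mod_cast hn
  have hm' : (0 : ℝ) < m := by exact_mod_cast hm
  rcases J.eq_empty_or_nonempty with h | h
  · rw [h, Finset.card_empty, Nat.cast_zero]; positivity
  set t := (a + s) * ((n : ℝ) + m) with ht
  obtain ⟨j, hj, hmin⟩ := Finset.exists_min_image _ (fun j => R (.inr j)) h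
  by_cases hjt : Sum.inr j ∈ strictTop R t
  · have h1 : J.map Function.Embedding.inr ⊆
        Finset.univ.map (Function.Embedding.inr (α := Fin n)) ∩ strictTop R t := by
      intro b hb
      obtain ⟨c, hc, rfl⟩ := Finset.mem_map.1 hb
      exact Finset.mem_inter.2 ⟨by simp, mem_strictTop_of_le hjt (hmin c hc)⟩
    have h2 : (J.card : ℝ) ≤
        (Finset.univ.map (Function.Embedding.inr (α := Fin n)) ∩ strictTop R t).card := by
      rw [← Finset.card_map (Function.Embedding.inr (α := Fin n))]
      exact_mod_cast Finset.card_le_card h1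
    have h3 : ((strictTop R t).card : ℝ) / (n + m) ≤ a + s := by
      rw [div_le_iff₀ (by positivity)]; exact card_strictTop_le R (by positivity)
    nlinarith
  · exfalso
    have h1 : (Finset.univ.filter fun i : Fin n => ¬ R (.inr j) ≤ R (.inl i)).map
        Function.Embedding.inl ⊆
        Finset.univ.map (Function.Embedding.inl (β := Fin m)) ∩ weakBottom R t := by
      intro b hb
      obtain ⟨c, hc, rfl⟩ := Finset.mem_map.1 hb
      exact Finset.mem_inter.2 ⟨by simp, mem_weakBottom_of_lt hjt
        (not_le.1 (Finset.mem_filter.1 hc).2)⟩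
    have h2 := Finset.card_le_card h1
    rw [Finset.card_map] at h2
    have h2' : ((Finset.univ.filter fun i : Fin n => ¬ R (.inr j) ≤ R (.inl i)).card : ℝ) ≤
      (Finset.univ.map (Function.Embedding.inl (β := Fin m)) ∩ weakBottom R t).card := by
      exact_mod_cast h2
    have h3 : ((Finset.univ.filter fun i : Fin n => R (.inr j) ≤ R (.inl i)).card : ℝ) +
        (Finset.univ.filter fun i : Fin n => ¬ R (.inr j) ≤ R (.inl i)).card = n := by
      exact_mod_cast (Finset.card_filter_add_card_filter_not
        (fun i : Fin n => R (.inr j) ≤ R (.inl i))).trans (by simp)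
    have h4 : ((weakBottom R t).card : ℝ) / (n + m) ≤ 1 - (a + s) := by
      rw [div_le_iff₀ (by positivity)]
      have := card_weakBottom_le R (t := t) (by
        simp only [Fintype.card_sum, Fintype.card_fin]; push_cast; nlinarith)
      simp only [Fintype.card_sum, Fintype.card_fin] at this
      push_cast at this
      linarith
    have h5 := hJ j hj
    nlinarith

/-- If few pairs are exceptional, then few columns hold many exceptional pairs. -/
theorem card_heavy_columns_le (bad : Fin n → Fin m → Prop) [∀ i j, Decidable (bad i j)]
    (hn : 0 < n) {κ : ℝ} (hκ : 0 ≤ κ)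
    (h : ((Finset.univ.filter fun p : Fin n × Fin m => bad p.1 p.2).card : ℝ) ≤ κ ^ 2 * (n * m)) :
    ((Finset.univ.filter fun j : Fin m =>
      κ * n < (Finset.univ.filter fun i => bad i j).card).card : ℝ) ≤ κ * m := by
  have hn' : (0 : ℝ) < n := by exact_mod_cast hn
  set H := Finset.univ.filter fun j : Fin m => κ * n < (Finset.univ.filter fun i => bad i j).card
  have hsum : ((Finset.univ.filter fun p : Fin n × Fin m => bad p.1 p.2).card : ℝ) =
      ∑ j : Fin m, ((Finset.univ.filter fun i => bad i j).card : ℝ) := by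
    simp_rw [← Finset.sum_boole]
    rw [Fintype.sum_prod_type_right]
  have hle : ∑ j ∈ H, ((Finset.univ.filter fun i => bad i j).card : ℝ) ≤ κ ^ 2 * (n * m) := by
    refine le_trans ?_ (hsum ▸ h)
    exact Finset.sum_le_sum_of_subset_of_nonneg (Finset.filter_subset _ _) fun _ _ _ => by positivity
  rcases H.eq_empty_or_nonempty with hH | hH
  · rw [hH, Finset.card_empty, Nat.cast_zero]; positivity
  have hlt : (H.card : ℝ) * (κ * n) < ∑ j ∈ H, ((Finset.univ.filter fun i => bad i j).card : ℝ) := by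
    rw [← nsmul_eq_mul, ← Finset.sum_const]
    exact Finset.sum_lt_sum_of_nonempty hH fun j hj => (Finset.mem_filter.1 hj).2
  by_contra! hc
  have := mul_le_mul_of_nonneg_right hc.le (show 0 ≤ κ * n by positivity)
  nlinarith

theorem card_exceed_lt (hn : 0 < n) (hm : 0 < m) (R : Fin n ⊕ Fin m → ℝ)
    (r : Fin n → ℝ) (d : Fin n → Fin m → ℝ) (bad : Fin n → Fin m → Prop)
    [∀ i j, Decidable (bad i j)] {α κ s ε : ℝ} (hα0 : 0 ≤ α) (hα1 : α ≤ 1)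
    (hκ : 0 ≤ κ) (hs : 0 < s) (has : α + κ + s ≤ 1)
    (htop : ((Finset.univ.map Function.Embedding.inr ∩
        strictTop R ((α + κ + s) * (n + m))).card : ℝ) <
      m * ((strictTop R ((α + κ + s) * (n + m))).card / (n + m)) + m * s)
    (hbot : ((Finset.univ.map Function.Embedding.inl ∩
        weakBottom R ((α + κ + s) * (n + m))).card : ℝ) <
      n * ((weakBottom R ((α + κ + s) * (n + m))).card / (n + m)) + n * s)
    (hbad : ((Finset.univ.filter fun p : Fin n × Fin m => bad p.1 p.2).card : ℝ) ≤
      κ ^ 2 * (n * m))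
    (hgood : ∀ i j, ¬ bad i j → R (.inl i) ≤ r i + ε ∧ d i j ≤ R (.inr j) + ε) :
    ((Finset.univ.filter fun j : Fin m => (1 - α) * ((n : ℝ) + 1) ≤
      (Finset.univ.filter fun i => r i + 2 * ε < d i j).card).card : ℝ) <
      m * (α + 2 * κ + 2 * s) := by
  set U := Finset.univ.filter fun j : Fin m => (1 - α) * ((n : ℝ) + 1) ≤
      (Finset.univ.filter fun i => r i + 2 * ε < d i j).card
  set H := Finset.univ.filter fun j : Fin m => κ * n < (Finset.univ.filter fun i => bad i j).card
  have hH : (H.card : ℝ) ≤ κ * m := card_heavy_columns_le bad hn hκ hbad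
  have hJ : ((U \ H).card : ℝ) < m * (α + κ + 2 * s) := by
    refine card_lt_of_few_larger hn hm R (by positivity) hs has htop hbot _ fun j hj => ?_
    obtain ⟨hjU, hjH⟩ := Finset.mem_sdiff.1 hj
    have h1 := (Finset.mem_filter.1 hjU).2
    have h2 : ((Finset.univ.filter fun i => bad i j).card : ℝ) ≤ κ * n := by
      simpa [H] using hjH
    have h3 : (Finset.univ.filter fun i => r i + 2 * ε < d i j) ⊆
        (Finset.univ.filter fun i : Fin n => ¬ R (.inr j) ≤ R (.inl i)) ∪
        Finset.univ.filter fun i => bad i j := by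
      intro i hi
      have hi' := (Finset.mem_filter.1 hi).2
      by_cases hb : bad i j
      · exact Finset.mem_union_right _ (by simpa using hb)
      · refine Finset.mem_union_left _ (Finset.mem_filter.2 ⟨Finset.mem_univ _, ?_⟩)
        obtain ⟨h1, h2⟩ := hgood i j hb
        rw [not_le]; linarith
    have h4 : ((Finset.univ.filter fun i => r i + 2 * ε < d i j).card : ℝ) ≤
        (Finset.univ.filter fun i : Fin n => ¬ R (.inr j) ≤ R (.inl i)).card +
        (Finset.univ.filter fun i => bad i j).card := by
      exact_mod_cast (Finset.card_le_card h3).trans (Finset.card_union_le _ _)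
    have h5 : ((Finset.univ.filter fun i : Fin n => R (.inr j) ≤ R (.inl i)).card : ℝ) +
        (Finset.univ.filter fun i : Fin n => ¬ R (.inr j) ≤ R (.inl i)).card = n := by
      exact_mod_cast (Finset.card_filter_add_card_filter_not
        (fun i : Fin n => R (.inr j) ≤ R (.inl i))).trans (by simp)
    -- As `(1 - α)(n + 1) ≥ (1 - α) n`, discarding at most `κ n` bad indices leaves at most `(α + κ)
    -- n` training residuals that are at least `R (.inr j)`.
    nlinarith
  have hU : (U.card : ℝ) ≤ (U \ H).card + H.card := by
    exact_mod_cast Finset.card_le_card_sdiff_add_card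
  nlinarith

end Counting

/-- The left side is `δ ^ (M / N)`. With `N = min n m`, one deviation serves both blocks. -/
theorem exp_neg_two_mul_sq_le {δ : ℝ} (hδ0 : 0 < δ) (hδ1 : δ < 1) {M N : ℕ} (hN : 0 < N)
    (hNM : N ≤ M) : Real.exp (-2 * M * √(Real.log (1 / δ) / (2 * (N : ℝ))) ^ 2) ≤ δ := by
  have hN' : (0 : ℝ) < N := by exact_mod_cast hN
  have hNM' : (N : ℝ) ≤ M := by exact_mod_cast hNM
  have hl : 0 < Real.log (1 / δ) := Real.log_pos (by rw [lt_div_iff₀ hδ0]; linarith)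
  rw [Real.sq_sqrt (by positivity), ← Real.le_log_iff_exp_le hδ0]
  have h1 : Real.log δ = -Real.log (1 / δ) := by simp
  rw [h1]
  have h2 : Real.log (1 / δ) ≤ 2 * M * (Real.log (1 / δ) / (2 * N)) := by
    rw [← mul_div_assoc, le_div_iff₀ (by positivity)]; nlinarith
  linarith

/-- A Markov bound: if each of the events `B p` has probability at most `κ ^ 3`, then with
probability at least `1 - κ` at most a fraction `κ ^ 2` of them occurs. -/
theorem measure_many_occur_le {Ω I : Type*} [MeasurableSpace Ω] [Fintype I] (Q : Measure Ω)
    (B : I → Set Ω) (hB : ∀ p, MeasurableSet (B p)) [∀ p, DecidablePred (· ∈ B p)] {κ : ℝ}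
    (hκ : 0 ≤ κ) (hI : 0 < Fintype.card I) (h : ∀ p, Q (B p) ≤ ENNReal.ofReal (κ ^ 3)) :
    Q {ω | κ ^ 2 * Fintype.card I < (Finset.univ.filter fun p => ω ∈ B p).card} ≤
      ENNReal.ofReal κ := by
  have hI' : (0 : ℝ) < Fintype.card I := by exact_mod_cast hI
  -- For `κ = 0` the Markov threshold vanishes and cannot be cancelled, but then all the events are
  -- null.
  rcases hκ.eq_or_lt with rfl | hpos
  · refine le_of_eq_of_le (measure_mono_null (t := ⋃ p, B p) (fun ω hω => ?_)
      (measure_iUnion_null fun p => ?_)) zero_le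
    · have h0 : 0 < (Finset.univ.filter fun p => ω ∈ B p).card := by
        have : (0 : ℝ) ^ 2 * Fintype.card I < (Finset.univ.filter fun p => ω ∈ B p).card := hω
        rw [zero_pow two_ne_zero, zero_mul] at this
        exact_mod_cast this
      obtain ⟨p, hp⟩ := Finset.card_pos.1 h0
      exact Set.mem_iUnion.2 ⟨p, (Finset.mem_filter.1 hp).2⟩
    · simpa using h p
  · set c : ℝ := κ ^ 2 * Fintype.card I
    have hc : 0 < c := by positivity
    have hsum : ∀ ω, ∑ p, (B p).indicator (1 : Ω → ℝ≥0∞) ω =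
        ((Finset.univ.filter fun p => ω ∈ B p).card : ℝ≥0∞) := fun ω => by
      simp [Set.indicator_apply, Finset.sum_boole]
    have hm : Measurable fun ω => ∑ p, (B p).indicator (1 : Ω → ℝ≥0∞) ω :=
      Finset.measurable_sum _ fun p _ => measurable_one.indicator (hB p)
    have h1 := mul_meas_ge_le_lintegral₀ (μ := Q) hm.aemeasurable (ENNReal.ofReal c)
    have h2 : ∫⁻ ω, ∑ p, (B p).indicator (1 : Ω → ℝ≥0∞) ω ∂Q ≤
        ENNReal.ofReal c * ENNReal.ofReal κ := by
      rw [lintegral_finsetSum _ fun p _ => measurable_one.indicator (hB p)]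
      calc _ = ∑ p, Q (B p) := Finset.sum_congr rfl fun p _ => lintegral_indicator_one (hB p)
        _ ≤ ∑ _p : I, ENNReal.ofReal (κ ^ 3) := Finset.sum_le_sum fun p _ => h p
        _ = ENNReal.ofReal c * ENNReal.ofReal κ := by
          rw [Finset.sum_const, Finset.card_univ, nsmul_eq_mul, ← ENNReal.ofReal_natCast,
            ← ENNReal.ofReal_mul hI'.le, ← ENNReal.ofReal_mul hc.le]
          congr 1; simp only [c]; ring
    refine le_trans (measure_mono fun ω hω => ?_) ((ENNReal.mul_le_mul_iff_right
      (by simpa using hc) ENNReal.ofReal_ne_top).1 (h1.trans h2))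
    have hω' : c < (Finset.univ.filter fun p => ω ∈ B p).card := hω
    change ENNReal.ofReal c ≤ ∑ p, (B p).indicator (1 : Ω → ℝ≥0∞) ω
    rw [hsum, ← ENNReal.ofReal_natCast]
    exact ENNReal.ofReal_le_ofReal hω'.le

/-- Hoeffding's inequality for fresh i.i.d. points, conditionally on `D`. -/
theorem measure_fresh_deviation_le {X Z ι : Type*} [MeasurableSpace X] [MeasurableSpace Z]
    [Fintype ι] (μ : Measure X) [IsProbabilityMeasure μ] (P : Measure Z) [IsProbabilityMeasure P]
    {E : Set (X × Z)} (hE : MeasurableSet E) [DecidablePred (· ∈ E)]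
    (hι : 0 < Fintype.card ι) {s : ℝ} (hs : 0 ≤ s) :
    (μ.prod (Measure.pi fun _ : ι => P)) {w | ((Finset.univ.filter fun j => (w.1, w.2 j) ∈ E).card
      : ℝ) + Fintype.card ι * s ≤ Fintype.card ι * P.real {z | (w.1, z) ∈ E}} ≤
      ENNReal.ofReal (Real.exp (-2 * Fintype.card ι * s ^ 2)) := by
  classical
  have hcount : Measurable fun w : X × (ι → Z) =>
      ((Finset.univ.filter fun j => (w.1, w.2 j) ∈ E).card : ℝ) := by
    simp_rw [← Finset.sum_boole]
    refine Finset.measurable_sum _ fun j _ => Measurable.ite ?_ measurable_const measurable_const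
    exact (measurable_fst.prodMk ((measurable_pi_apply j).comp measurable_snd)) hE
  have hprob : Measurable fun w : X × (ι → Z) => P.real {z | (w.1, z) ∈ E} :=
    ((measurable_measure_prodMk_left hE).ennreal_toReal).comp measurable_fst
  rw [Measure.prod_apply (measurableSet_le (hcount.add_const _) (hprob.const_mul _))]
  refine (lintegral_mono (g := fun _ => ENNReal.ofReal (Real.exp (-2 * Fintype.card ι * s ^ 2)))
    fun x => ?_).trans (by simp)
  have hEx : MeasurableSet {z | (x, z) ∈ E} := measurable_prodMk_left hE
  -- With the training data fixed, too few hits of `E` means too many hits of its complement.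
  refine le_trans (measure_mono fun z hz => ?_)
    (measure_card_deviation_le (ι := ι) P hEx.compl hι hs)
  have hz' : ((Finset.univ.filter fun j => (x, z j) ∈ E).card : ℝ) + Fintype.card ι * s ≤
    Fintype.card ι * P.real {z | (x, z) ∈ E} := hz
  have h1 : ((Finset.univ.filter fun j => (x, z j) ∈ E).card : ℝ) +
      (Finset.univ.filter fun j => z j ∈ {z | (x, z) ∈ E}ᶜ).card = Fintype.card ι := by
    exact_mod_cast Finset.card_filter_add_card_filter_not (s := Finset.univ)
      (fun j : ι => (x, z j) ∈ E)
  have h2 : P.real {z | (x, z) ∈ E}ᶜ = 1 - P.real {z | (x, z) ∈ E} := probReal_compl_eq_one_sub hEx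
  change (Fintype.card ι : ℝ) * P.real {z | (x, z) ∈ E}ᶜ + Fintype.card ι * s ≤ _
  rw [h2]
  linarith

/-! ### Symmetry and stability of the algorithm -/

section Algorithm

variable {𝒳 : Type*} [MeasurableSpace 𝒳] (A : RegressionAlgorithm 𝒳)

theorem leaveOneOut_eq_comp_succAbove {Z : Type*} {k : ℕ} (D : Fin (k + 1) → Z) (i : Fin (k + 1)) :
    leaveOneOut D i = fun j : Fin k => D (i.succAbove j) := by
  funext j
  simp only [leaveOneOut]
  congr 1
  ext
  simp only [Fin.succAbove, Fin.lt_def, Fin.val_castSucc]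
  split_ifs <;> rfl

theorem looModel_succ {k : ℕ} (D : Fin (k + 1) → 𝒳 × ℝ) (i : Fin (k + 1)) :
    looModel A D i = A.fit k (D ∘ i.succAbove) := by
  unfold looModel
  rw [leaveOneOut_eq_comp_succAbove]
  rfl

/-- Two injective enumerations of the same index set differ by a permutation, so a fitted model
depends only on which points are used. -/
theorem fit_comp_eq_of_range_eq {ι : Type*} {M : ℕ} {f g : Fin M → ι}
    (hf : Function.Injective f) (hg : Function.Injective g) (h : Set.range f = Set.range g)
    (D : ι → 𝒳 × ℝ) : A.fit M (D ∘ f) = A.fit M (D ∘ g) := by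
  let π : Equiv.Perm (Fin M) :=
    (Equiv.ofInjective f hf).trans ((Equiv.setCongr h).trans (Equiv.ofInjective g hg).symm)
  have hπ : g ∘ π = f := by
    funext j
    exact congrArg Subtype.val ((Equiv.ofInjective g hg).apply_symm_apply
      (Equiv.setCongr h (Equiv.ofInjective f hf j)))
  rw [← hπ, ← Function.comp_assoc, A.symmetric_fit]

theorem measurable_fit_comp {ι : Type*} {M : ℕ} (f : Fin M → ι) (c : ι) :
    Measurable fun D : ι → 𝒳 × ℝ => A.fit M (D ∘ f) (D c).1 :=
  have h : Measurable fun D : ι → 𝒳 × ℝ => (D ∘ f, (D c).1) :=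
    (measurable_pi_iff.2 fun i => measurable_pi_apply (f i)).prodMk
      (measurable_fst.comp (measurable_pi_apply c))
  (A.measurable_fit M).comp h

/-- The residual at the index `a` of the model fitted to the points with indices `e a`. -/
def omitResidual {ι : Type*} {M : ℕ} (e : ι → Fin M → ι) (D : ι → 𝒳 × ℝ) (a : ι) : ℝ :=
  |(D a).2 - A.fit M (D ∘ e a) (D a).1|

theorem measurable_omitResidual {ι : Type*} {M : ℕ} (e : ι → Fin M → ι) (a : ι) :
    Measurable fun D : ι → 𝒳 × ℝ => omitResidual A e D a := by
  have h := ((measurable_snd (α := 𝒳) (β := ℝ)).comp (measurable_pi_apply a)).sub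
    (measurable_fit_comp A (e a) a)
  exact continuous_abs.measurable.comp h

/-- Both `π ∘ e a` and `e (π a)` enumerate the complement of `π a`. -/
theorem omitResidual_comp_perm {ι : Type*} {M : ℕ} {e : ι → Fin M → ι}
    (he : ∀ a, Function.Injective (e a)) (her : ∀ a, Set.range (e a) = {a}ᶜ)
    (π : Equiv.Perm ι) (D : ι → 𝒳 × ℝ) (a : ι) :
    omitResidual A e (D ∘ π) a = omitResidual A e D (π a) := by
  have : A.fit M (D ∘ (π ∘ e a)) = A.fit M (D ∘ e (π a)) := by
    refine fit_comp_eq_of_range_eq A (π.injective.comp (he a)) (he _) ?_ D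
    rw [Set.range_comp, her, her, Set.image_compl_eq π.bijective, Set.image_singleton]
  simp only [omitResidual, Function.comp_apply, Function.comp_assoc, this]

theorem exists_enumeration_compl_singleton {ι : Type*} [Fintype ι] {M : ℕ}
    (h : Fintype.card ι = M + 1) (a : ι) :
    ∃ f : Fin M → ι, Function.Injective f ∧ Set.range f = {a}ᶜ := by
  classical
  have hc : Fintype.card {x // x ≠ a} = M := by
    rw [Fintype.card_subtype_compl, h]; simp
  let e := (Fintype.equivFinOfCardEq hc).symm
  refine ⟨fun j => (e j).1, Subtype.val_injective.comp e.injective, ?_⟩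
  ext x
  constructor
  · rintro ⟨j, rfl⟩; exact (e j).2
  · intro hx; exact ⟨e.symm ⟨x, hx⟩, by simp⟩

/-- The points indexed by `f` act as the training set and the point `c` as the independent test
point of `stabilityProb`. -/
theorem measure_unstable_le {ι : Type*} [Fintype ι] (P : Measure (𝒳 × ℝ)) [IsProbabilityMeasure P]
    {k m : ℕ} {ε ν : ℝ} (hstab : ENNReal.ofReal (1 - ν) ≤ stabilityProb A P k m ε)
    {f : Fin (k + m) → ι} (hf : Function.Injective f) {c : ι} (hc : c ∉ Set.range f) :
    (Measure.pi fun _ : ι => P) {D | ¬ |A.fit k (D ∘ f ∘ Fin.castAdd m) (D c).1 -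
      A.fit (k + m) (D ∘ f) (D c).1| ≤ ε} ≤ ENNReal.ofReal ν := by
  have hg : Function.Injective (Fin.cons c f : Fin (k + m + 1) → ι) :=
    Fin.cons_injective_iff.2 ⟨hc, hf⟩
  have h1 := measurePreserving_comp_of_injective P hg
  have h2 := measurePreserving_piFinSuccAbove (fun _ : Fin (k + m + 1) => P) 0
  have h3 := Measure.measurePreserving_swap (μ := P)
    (ν := Measure.pi fun _ : Fin (k + m) => P)
  have h := h3.comp (h2.comp h1)
  set S := {w : (Fin (k + m) → 𝒳 × ℝ) × (𝒳 × ℝ) |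
    |A.fit k (fun i => w.1 (Fin.castAdd m i)) w.2.1 - A.fit (k + m) w.1 w.2.1| ≤ ε} with hSdef
  have hS : MeasurableSet S := by
    refine measurableSet_le (continuous_abs.measurable.comp (Measurable.sub ?_ ?_)) measurable_const
    · have h : Measurable fun w : (Fin (k + m) → 𝒳 × ℝ) × (𝒳 × ℝ) =>
          (fun i => w.1 (Fin.castAdd m i), w.2.1) :=
        (measurable_pi_iff.2 fun i => (measurable_pi_apply (Fin.castAdd m i)).comp
          measurable_fst).prodMk (measurable_fst.comp measurable_snd)
      exact (A.measurable_fit k).comp h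
    · exact (A.measurable_fit (k + m)).comp (measurable_fst.prodMk
        (measurable_fst.comp measurable_snd))
  have hpre := h.measure_preimage hS.compl.nullMeasurableSet
  have hcompl : ((Measure.pi fun _ : Fin (k + m) => P).prod P) Sᶜ ≤ ENNReal.ofReal ν := by
    rw [prob_compl_eq_one_sub hS]
    change ENNReal.ofReal (1 - ν) ≤ ((Measure.pi fun _ : Fin (k + m) => P).prod P) S at hstab
    rw [tsub_le_iff_right]
    calc (1 : ℝ≥0∞) = ENNReal.ofReal (ν + (1 - ν)) := by simp
      _ ≤ ENNReal.ofReal ν + ENNReal.ofReal (1 - ν) := ENNReal.ofReal_add_le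
      _ ≤ _ := by gcongr
  rw [← hpre] at hcompl
  exact hcompl

end Algorithm

/-! ### Intervals, exceedance counts and the density bound -/

section Intervals

theorem empQuantile_lt_coe_iff {n : ℕ} (v : Fin n → ℝ) (τ y : ℝ) :
    empQuantile v τ < (y : EReal) ↔ τ * n ≤ ((Finset.univ.filter fun i => v i < y).card : ℝ) := by
  unfold empQuantile
  rw [sInf_lt_iff]
  constructor
  · rintro ⟨t, ht, hty⟩
    refine le_trans (show _ from ht) ?_
    exact_mod_cast Finset.card_le_card (Finset.monotone_filter_right _ fun i _ hi =>
      EReal.coe_lt_coe_iff.1 (lt_of_le_of_lt hi hty))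
  · intro h
    rcases (Finset.univ.filter fun i => v i < y).eq_empty_or_nonempty with he | he
    · rw [he, Finset.card_empty, Nat.cast_zero] at h
      -- With no value below `y` the level satisfies `τ * n ≤ 0`, so the quantile is `-∞`; otherwise
      -- the largest value below `y` is a witness.
      exact ⟨⊥, h.trans (Nat.cast_nonneg _), EReal.bot_lt_coe y⟩
    · obtain ⟨i, hi, hmax⟩ := Finset.exists_max_image _ v he
      refine ⟨(v i : EReal), h.trans ?_, EReal.coe_lt_coe_iff.2 (Finset.mem_filter.1 hi).2⟩
      exact_mod_cast Finset.card_le_card fun j hj =>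
        Finset.mem_filter.2 ⟨Finset.mem_univ _, EReal.coe_le_coe_iff.2 (hmax j hj)⟩

theorem coe_le_add_coe_iff (U : EReal) (y γ : ℝ) :
    (y : EReal) ≤ U + γ ↔ ((y - γ : ℝ) : EReal) ≤ U := by
  induction U with
  | bot => simp [-EReal.coe_sub]
  | top => simp
  | coe u => norm_cast; constructor <;> intro h <;> linarith

theorem sub_coe_le_coe_iff (L : EReal) (y γ : ℝ) :
    L - γ ≤ (y : EReal) ↔ L ≤ ((y + γ : ℝ) : EReal) := by
  induction L with
  | bot => simp
  | top => simp [-EReal.coe_add]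
  | coe u => norm_cast; constructor <;> intro h <;> linarith

/-- Inflation does not move an infinite endpoint, and a negative `γ` leaves an empty strip. -/
theorem volume_between_add_le (U : EReal) (γ : ℝ) :
    volume {y : ℝ | U < y ∧ (y : EReal) ≤ U + γ} ≤ ENNReal.ofReal γ := by
  induction U with
  | bot => simp
  | top => simp
  | coe u =>
    have : {y : ℝ | (u : EReal) < y ∧ (y : EReal) ≤ u + γ} = Set.Ioc u (u + γ) := by
      ext y
      simp only [Set.mem_ofPred_eq, Set.mem_Ioc]
      norm_cast
    rw [this, Real.volume_Ioc]; simp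

theorem volume_between_sub_le (L : EReal) (γ : ℝ) :
    volume {y : ℝ | (y : EReal) < L ∧ L - γ ≤ (y : EReal)} ≤ ENNReal.ofReal γ := by
  induction L with
  | bot => simp
  | top => simp
  | coe u =>
    have : {y : ℝ | (y : EReal) < u ∧ (u : EReal) - γ ≤ y} = Set.Ico (u - γ) u := by
      ext y
      simp only [Set.mem_ofPred_eq, Set.mem_Ico]
      norm_cast
      exact and_comm
    rw [this, Real.volume_Ico]; simp

variable {𝒳 : Type*} [MeasurableSpace 𝒳] (A : RegressionAlgorithm 𝒳)

theorem mem_inflatedJackInterval_iff {n : ℕ} (α γ : ℝ) (D : Fin n → 𝒳 × ℝ) (x : 𝒳) (y : ℝ) :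
    y ∈ inflatedJackInterval A α γ D x ↔
      ¬ ((1 - α) * (1 + 1 / (n : ℝ)) * n ≤ ((Finset.univ.filter fun i =>
        -looModel A D i x + looResidual A D i < -(y + γ)).card : ℝ)) ∧
      ¬ ((1 - α) * (1 + 1 / (n : ℝ)) * n ≤ ((Finset.univ.filter fun i =>
        looModel A D i x + looResidual A D i < y - γ).card : ℝ)) := by
  rw [← empQuantile_lt_coe_iff, ← empQuantile_lt_coe_iff, not_lt, not_lt]
  change _ - _ ≤ _ ∧ _ ≤ _ + _ ↔ _
  rw [coe_le_add_coe_iff, sub_coe_le_coe_iff]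
  refine and_congr ?_ Iff.rfl
  rw [jackLower, EReal.coe_neg]
  exact EReal.neg_le

theorem inflatedJackInterval_zero {n : ℕ} (α : ℝ) (D : Fin n → 𝒳 × ℝ) (x : 𝒳) :
    inflatedJackInterval A α 0 D x = jackInterval A α D x := by
  simp [inflatedJackInterval, jackInterval]

theorem measurable_looModel {n : ℕ} (i : Fin n) :
    Measurable fun w : (Fin n → 𝒳 × ℝ) × 𝒳 => looModel A w.1 i w.2 := by
  have h : Measurable fun w : (Fin n → 𝒳 × ℝ) × 𝒳 => (leaveOneOut w.1 i, w.2) :=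
    (measurable_pi_iff.2 fun _ => (measurable_pi_apply _).comp measurable_fst).prodMk measurable_snd
  exact (A.measurable_fit (n - 1)).comp h

theorem measurable_looResidual {n : ℕ} (i : Fin n) :
    Measurable fun D : Fin n → 𝒳 × ℝ => looResidual A D i := by
  have h : Measurable fun D : Fin n → 𝒳 × ℝ => (D, (D i).1) :=
    measurable_id.prodMk (measurable_fst.comp (measurable_pi_apply i))
  exact continuous_abs.measurable.comp
    ((measurable_snd.comp (measurable_pi_apply i)).sub ((measurable_looModel A i).comp h))

theorem measurableSet_mem_inflatedJackInterval {n : ℕ} (α γ : ℝ) (D : Fin n → 𝒳 × ℝ) :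
    MeasurableSet {z : 𝒳 × ℝ | z.2 ∈ inflatedJackInterval A α γ D z.1} := by
  have hmod : ∀ i, Measurable fun z : 𝒳 × ℝ => looModel A D i z.1 := fun i =>
    (measurable_looModel A i).comp (measurable_const.prodMk measurable_fst)
  have hlow : ∀ i, MeasurableSet {z : 𝒳 × ℝ |
      -looModel A D i z.1 + looResidual A D i < -(z.2 + γ)} := fun i =>
    measurableSet_lt ((hmod i).neg.add_const _) (measurable_snd.add_const _).neg
  have hup : ∀ i, MeasurableSet {z : 𝒳 × ℝ |
      looModel A D i z.1 + looResidual A D i < z.2 - γ} := fun i =>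
    measurableSet_lt ((hmod i).add_const _) (measurable_snd.sub_const _)
  simp_rw [mem_inflatedJackInterval_iff]
  classical
  have h1 := measurableSet_setOf_finite_pattern hlow
    (fun q => ¬ ((1 - α) * (1 + 1 / (n : ℝ)) * n ≤ ((Finset.univ.filter q).card : ℝ)))
  have h2 := measurableSet_setOf_finite_pattern hup
    (fun q => ¬ ((1 - α) * (1 + 1 / (n : ℝ)) * n ≤ ((Finset.univ.filter q).card : ℝ)))
  convert h1.inter h2 using 1
  ext z
  simp only [Set.mem_ofPred_eq, Set.mem_inter_iff]

/-- Pairs of a training set and a point `(x, y)` whose error under many of the leave-one-out models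
exceeds the leave-one-out residual by more than `γ`. -/
def exceedSet (n : ℕ) (α γ : ℝ) : Set ((Fin n → 𝒳 × ℝ) × (𝒳 × ℝ)) :=
  {w | (1 - α) * ((n : ℝ) + 1) ≤ ((Finset.univ.filter fun i =>
    looResidual A w.1 i + γ < |w.2.2 - looModel A w.1 i w.2.1|).card : ℝ)}

theorem measurableSet_exceedSet (n : ℕ) (α γ : ℝ) : MeasurableSet (exceedSet A n α γ) := by
  classical
  have h : ∀ i, MeasurableSet {w : (Fin n → 𝒳 × ℝ) × (𝒳 × ℝ) |
      looResidual A w.1 i + γ < |w.2.2 - looModel A w.1 i w.2.1|} := by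
    intro i
    have hp : Measurable fun w : (Fin n → 𝒳 × ℝ) × (𝒳 × ℝ) => (w.1, w.2.1) :=
      measurable_fst.prodMk (measurable_fst.comp measurable_snd)
    exact measurableSet_lt (((measurable_looResidual A i).comp measurable_fst).add_const _)
      (continuous_abs.measurable.comp ((measurable_snd.comp measurable_snd).sub
        ((measurable_looModel A i).comp hp)))
  convert measurableSet_setOf_finite_pattern h
    (fun q => (1 - α) * ((n : ℝ) + 1) ≤ ((Finset.univ.filter q).card : ℝ)) using 1
  ext w
  simp only [exceedSet, Set.mem_ofPred_eq]

/-- Missing the interval on either side makes a signed error large for at least `(1 - α)(n + 1)`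
models. The absolute error dominates both signs, so a single event covers both sides without a
factor two. -/
theorem mem_exceedSet_of_notMem {n : ℕ} (hn : 0 < n) {α γ : ℝ} {D : Fin n → 𝒳 × ℝ} {z : 𝒳 × ℝ}
    (h : z.2 ∉ inflatedJackInterval A α γ D z.1) : (D, z) ∈ exceedSet A n α γ := by
  have hn' : (0 : ℝ) < n := by exact_mod_cast hn
  have hτ : (1 - α) * (1 + 1 / (n : ℝ)) * n = (1 - α) * ((n : ℝ) + 1) := by field_simp
  rw [mem_inflatedJackInterval_iff, hτ] at h
  rw [← not_or, not_not] at h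
  rcases h with h | h <;> refine h.trans ?_
  · exact_mod_cast Finset.card_le_card (Finset.monotone_filter_right _ fun i _ hi => by
      have := neg_abs_le (z.2 - looModel A D i z.1)
      change _ < |_|
      linarith)
  · exact_mod_cast Finset.card_le_card (Finset.monotone_filter_right _ fun i _ hi => by
      have := le_abs_self (z.2 - looModel A D i z.1)
      change _ < |_|
      linarith)

/-- Over each `x`, inflation adds at most two strips of length `2 * ε`. Their conditional
probability is at most `4 * ε` times the supremum of the density, which is then integrated over `x`.
-/
theorem miscoverage_jackInterval_le {n : ℕ} (P : Measure (𝒳 × ℝ)) [IsProbabilityMeasure P]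
    (α ε : ℝ) (D : Fin n → 𝒳 × ℝ) {f : 𝒳 → ℝ → ℝ≥0∞} (hf : IsCondDensity P f) :
    miscoverage P (jackInterval A α D) ≤ miscoverage P (inflatedJackInterval A α (2 * ε) D) +
      4 * densBound P f * ENNReal.ofReal ε := by
  set S := {z : 𝒳 × ℝ | z.2 ∉ jackInterval A α D z.1 ∧
    z.2 ∈ inflatedJackInterval A α (2 * ε) D z.1}
  have hS : MeasurableSet S := by
    have h1 := measurableSet_mem_inflatedJackInterval A α 0 D
    simp_rw [inflatedJackInterval_zero] at h1
    exact h1.compl.inter (measurableSet_mem_inflatedJackInterval A α (2 * ε) D)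
  have hvol : ∀ x, volume (Prod.mk x ⁻¹' S) ≤ 4 * ENNReal.ofReal ε := by
    intro x
    have hsub : Prod.mk x ⁻¹' S ⊆
        {y : ℝ | (y : EReal) < jackLower A α D x ∧
          jackLower A α D x - ((2 * ε : ℝ) : EReal) ≤ (y : EReal)} ∪
        {y : ℝ | jackUpper A α D x < y ∧
          (y : EReal) ≤ jackUpper A α D x + ((2 * ε : ℝ) : EReal)} := by
      rintro y ⟨hy, hl, hu⟩
      by_cases h : (y : EReal) < jackLower A α D x
      · exact Or.inl ⟨h, hl⟩
      · exact Or.inr ⟨not_le.1 fun h' => hy ⟨not_lt.1 h, h'⟩, hu⟩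
    refine (measure_mono hsub).trans ((measure_union_le _ _).trans
      ((add_le_add (volume_between_sub_le _ _) (volume_between_add_le _ _)).trans ?_))
    rw [ENNReal.ofReal_mul zero_le_two, ENNReal.ofReal_ofNat, ← two_mul, ← mul_assoc]
    norm_num
  have hPS : P S ≤ 4 * densBound P f * ENNReal.ofReal ε := by
    conv_lhs => rw [← P.disintegrate P.condKernel]
    rw [Measure.compProd_apply hS]
    calc _ ≤ ∫⁻ x, (⨆ y : ℝ, f x y) * (4 * ENNReal.ofReal ε) ∂P.fst := by
          refine lintegral_mono_ae ?_
          filter_upwards [hf.2] with x hx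
          rw [hx, withDensity_apply _ (measurable_prodMk_left hS)]
          calc _ ≤ ∫⁻ _y in Prod.mk x ⁻¹' S, (⨆ y : ℝ, f x y) :=
                lintegral_mono fun y => le_iSup (f x) y
            _ = (⨆ y : ℝ, f x y) * volume (Prod.mk x ⁻¹' S) := setLIntegral_const _ _
            _ ≤ _ := by gcongr; exact hvol x
      _ = densBound P f * (4 * ENNReal.ofReal ε) :=
          lintegral_mul_const' _ _ (ENNReal.mul_ne_top (by simp) ENNReal.ofReal_ne_top)
      _ = _ := by ring
  calc miscoverage P (jackInterval A α D)
      ≤ P ({z | z.2 ∉ inflatedJackInterval A α (2 * ε) D z.1} ∪ S) := by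
        refine measure_mono fun z hz => ?_
        by_cases h : z.2 ∈ inflatedJackInterval A α (2 * ε) D z.1
        · exact Or.inr ⟨hz, h⟩
        · exact Or.inl h
    _ ≤ _ := (measure_union_le _ _).trans (add_le_add le_rfl hPS)

end Intervals

instance isProbabilityMeasure_iidLaw {𝒳 : Type*} [MeasurableSpace 𝒳] (P : Measure (𝒳 × ℝ))
    [IsProbabilityMeasure P] (n : ℕ) : IsProbabilityMeasure (iidLaw P n) :=
  inferInstanceAs (IsProbabilityMeasure (Measure.pi fun _ : Fin n => P))

/-! ### The four failure events -/

section MainBound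

theorem range_eq_compl_singleton_of_injective {ι : Type*} [Fintype ι] {M : ℕ}
    (h : Fintype.card ι = M + 1) {f : Fin M → ι} (hf : Function.Injective f) {a : ι}
    (ha : ∀ j, f j ≠ a) : Set.range f = {a}ᶜ := by
  classical
  have h1 : Finset.univ.image f = {a}ᶜ := by
    refine Finset.eq_of_subset_of_card_le (fun x hx => ?_) ?_
    · obtain ⟨j, -, rfl⟩ := Finset.mem_image.1 hx
      simpa using ha j
    · rw [Finset.card_image_of_injective _ hf, Finset.card_compl, h]; simp
  have h2 := congrArg (fun s : Finset ι => (s : Set ι)) h1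
  simpa using h2

/-- This enumerates everything but `inl i`, and its analogue with `Fin.cons` everything but `inr j`.
Both list the training points other than `i` first, so their initial segment is the leave-one-out
data. -/
theorem append_inl_inr_injective {k l : ℕ} (i : Fin (k + 1)) :
    Function.Injective (Fin.append (fun a => Sum.inl (i.succAbove a)) Sum.inr :
      Fin (k + (l + 1)) → Fin (k + 1) ⊕ Fin (l + 1)) := by
  rw [Fin.append_injective_iff]
  exact ⟨Sum.inl_injective.comp Fin.succAbove_right_injective, Sum.inr_injective, by simp⟩

theorem append_inl_inr_ne {k l : ℕ} (i : Fin (k + 1)) (a : Fin (k + (l + 1))) :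
    (Fin.append (fun a => Sum.inl (i.succAbove a)) Sum.inr :
      Fin (k + (l + 1)) → Fin (k + 1) ⊕ Fin (l + 1)) a ≠ Sum.inl i := by
  refine Fin.addCases (fun b => ?_) (fun b => ?_) a <;> simp [Fin.succAbove_ne]

theorem append_inl_cons_injective {k l : ℕ} (i : Fin (k + 1)) (j : Fin (l + 1)) :
    Function.Injective (Fin.append (fun a => Sum.inl (i.succAbove a))
      (Fin.cons (Sum.inl i) fun b => Sum.inr (j.succAbove b)) :
      Fin (k + (l + 1)) → Fin (k + 1) ⊕ Fin (l + 1)) := by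
  rw [Fin.append_injective_iff]
  refine ⟨Sum.inl_injective.comp Fin.succAbove_right_injective, Fin.cons_injective_iff.2
    ⟨by simp, Sum.inr_injective.comp Fin.succAbove_right_injective⟩, fun a b => ?_⟩
  refine Fin.cases ?_ (fun b => ?_) b <;> simp [Fin.succAbove_ne]

theorem append_inl_cons_ne {k l : ℕ} (i : Fin (k + 1)) (j : Fin (l + 1)) (a : Fin (k + (l + 1))) :
    (Fin.append (fun a => Sum.inl (i.succAbove a))
      (Fin.cons (Sum.inl i) fun b => Sum.inr (j.succAbove b)) :
      Fin (k + (l + 1)) → Fin (k + 1) ⊕ Fin (l + 1)) a ≠ Sum.inr j := by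
  refine Fin.addCases (fun b => ?_) (fun b => ?_) a
  · simp
  · refine Fin.cases ?_ (fun b => ?_) b <;> simp [Fin.succAbove_ne]

variable {𝒳 : Type*} [MeasurableSpace 𝒳] (A : RegressionAlgorithm 𝒳)

/-- The leave-one-out model without `i` is, at the point with index `c`, more than `ε` away from
the model fitted to all points but the one with index `c`. -/
def UnstableAt {k l M : ℕ} (e : Fin (k + 1) ⊕ Fin (l + 1) → Fin M → Fin (k + 1) ⊕ Fin (l + 1))
    (ε : ℝ) (i : Fin (k + 1)) (c : Fin (k + 1) ⊕ Fin (l + 1))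
    (D : Fin (k + 1) ⊕ Fin (l + 1) → 𝒳 × ℝ) : Prop :=
  ¬ |looModel A (D ∘ Sum.inl) i (D c).1 - A.fit M (D ∘ e c) (D c).1| ≤ ε

theorem measurableSet_unstableAt {k l M : ℕ}
    (e : Fin (k + 1) ⊕ Fin (l + 1) → Fin M → Fin (k + 1) ⊕ Fin (l + 1))
    (ε : ℝ) (i : Fin (k + 1)) (c : Fin (k + 1) ⊕ Fin (l + 1)) :
    MeasurableSet {D | UnstableAt A e ε i c D} := by
  simp only [UnstableAt, looModel_succ]
  have h := (measurable_fit_comp A (fun a => (Sum.inl (i.succAbove a) : Fin (k + 1) ⊕ Fin (l + 1))) c).sub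
    (measurable_fit_comp A (e c) c)
  exact (measurableSet_le (continuous_abs.measurable.comp h) measurable_const).compl

/-- The condition on `c` leaves `inl i` and the fresh indices. By symmetry `e c` may be replaced by
an enumeration that starts with the leave-one-out data, to which the stability assumption applies.
-/
theorem measure_unstableAt_le {k l : ℕ} (P : Measure (𝒳 × ℝ)) [IsProbabilityMeasure P] {ε ν : ℝ}
    (hstab : ENNReal.ofReal (1 - ν) ≤ stabilityProb A P k (l + 1) ε)
    {e : Fin (k + 1) ⊕ Fin (l + 1) → Fin (k + (l + 1)) → Fin (k + 1) ⊕ Fin (l + 1)}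
    (he : ∀ a, Function.Injective (e a)) (her : ∀ a, Set.range (e a) = {a}ᶜ)
    (i : Fin (k + 1)) (c : Fin (k + 1) ⊕ Fin (l + 1)) (hc : c ∉ Set.range fun a => Sum.inl (i.succAbove a)) :
    (Measure.pi fun _ => P) {D | UnstableAt A e ε i c D} ≤ ENNReal.ofReal ν := by
  have hcard : Fintype.card (Fin (k + 1) ⊕ Fin (l + 1)) = k + (l + 1) + 1 := by
    simp; omega
  obtain ⟨f, hf, hfc, hfl⟩ : ∃ f : Fin (k + (l + 1)) → Fin (k + 1) ⊕ Fin (l + 1),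
      Function.Injective f ∧ (∀ a, f a ≠ c) ∧
      f ∘ Fin.castAdd (l + 1) = fun a => Sum.inl (i.succAbove a) := by
    rcases c with c | j
    · obtain rfl : c = i := by
        by_contra h
        obtain ⟨a, rfl⟩ := Fin.exists_succAbove_eq h
        exact hc ⟨a, rfl⟩
      exact ⟨_, append_inl_inr_injective c, append_inl_inr_ne c, by funext a; simp⟩
    · exact ⟨_, append_inl_cons_injective i j, append_inl_cons_ne i j, by funext a; simp⟩
  have hrange := range_eq_compl_singleton_of_injective hcard hf hfc
  have h := measure_unstable_le A P hstab hf (c := c) (by rw [hrange]; simp)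
  have hset : {D | UnstableAt A e ε i c D} = {D : Fin (k + 1) ⊕ Fin (l + 1) → 𝒳 × ℝ |
      ¬ |A.fit k (D ∘ f ∘ Fin.castAdd (l + 1)) (D c).1 - A.fit (k + (l + 1)) (D ∘ f) (D c).1| ≤ ε} := by
    ext D
    have h1 : A.fit (k + (l + 1)) (D ∘ f) = A.fit (k + (l + 1)) (D ∘ e c) :=
      fit_comp_eq_of_range_eq A hf (he c) (by rw [hrange, her]) D
    simp only [UnstableAt, looModel_succ, Set.mem_ofPred_eq, h1, hfl]
    rfl
  rw [hset]
  exact h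

/-- The training-conditional probability of `exceedSet` is large with small probability only. -/
theorem measure_exceedSet_large_le {k l : ℕ} (P : Measure (𝒳 × ℝ)) [IsProbabilityMeasure P]
    {α δ ε ν κ s : ℝ} (hα0 : 0 ≤ α) (hα1 : α ≤ 1) (hδ : 0 ≤ δ) (hκ : 0 ≤ κ) (hκν : κ ^ 3 = 2 * ν)
    (hs : 0 < s) (hsn : Real.exp (-2 * (k + 1 : ℕ) * s ^ 2) ≤ δ)
    (hsm : Real.exp (-2 * (l + 1 : ℕ) * s ^ 2) ≤ δ) (has : α + κ + s ≤ 1)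
    (hstab : ENNReal.ofReal (1 - ν) ≤ stabilityProb A P k (l + 1) ε) :
    iidLaw P (k + 1) {D | α + 3 * s + 2 * κ ≤
      P.real {z | (D, z) ∈ exceedSet A (k + 1) α (2 * ε)}} ≤ ENNReal.ofReal (3 * δ + κ) := by
  classical
  set n := k + 1 with hn
  set m := l + 1 with hm
  let ι := Fin n ⊕ Fin m
  have hn0 : 0 < n := Nat.succ_pos _
  have hm0 : 0 < m := Nat.succ_pos _
  have hcard : Fintype.card ι = k + m + 1 := by
    simp only [ι, Fintype.card_sum, Fintype.card_fin]; omega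
  have hcardR : ((Fintype.card ι : ℕ) : ℝ) = n + m := by simp [ι]
  choose e he her using exists_enumeration_compl_singleton hcard
  set E := exceedSet A n α (2 * ε)
  have hE : MeasurableSet E := measurableSet_exceedSet A n α (2 * ε)
  set Q := Measure.pi fun _ : ι => P
  set R := fun D : ι → 𝒳 × ℝ => omitResidual A e D
  set t := (α + κ + s) * ((n : ℝ) + m)
  have hRle : ∀ p : ι × ι, MeasurableSet {D | R D p.1 ≤ R D p.2} := fun p =>
    measurableSet_le (measurable_omitResidual A e p.1) (measurable_omitResidual A e p.2)
  have hRlt : ∀ p : ι × ι, MeasurableSet {D | R D p.1 < R D p.2} := fun p =>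
    measurableSet_lt (measurable_omitResidual A e p.1) (measurable_omitResidual A e p.2)
  have hRcomp : ∀ (π : Equiv.Perm ι) D a, R (D ∘ π) a = R D (π a) :=
    omitResidual_comp_perm A he her
  -- `B1`: the fresh points under-represent the exceedance probability. `B2` and `B3`: the fresh
  -- block has too many high ranks, or the training block too many low ones. `B4`: too many unstable
  -- pairs.
  let B1 : Set (ι → 𝒳 × ℝ) := {D |
    ((Finset.univ.filter fun j => (D ∘ Sum.inl, D (Sum.inr j)) ∈ E).card : ℝ) + m * s ≤
      m * P.real {z | (D ∘ Sum.inl, z) ∈ E}}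
  let B2 : Set (ι → 𝒳 × ℝ) := {D | (m : ℝ) * ((strictTop (R D) t).card / (n + m)) + m * s ≤
    (Finset.univ.map Function.Embedding.inr ∩ strictTop (R D) t).card}
  let B3 : Set (ι → 𝒳 × ℝ) := {D | (n : ℝ) * ((weakBottom (R D) t).card / (n + m)) + n * s ≤
    (Finset.univ.map Function.Embedding.inl ∩ weakBottom (R D) t).card}
  let W : Fin n × Fin m → Set (ι → 𝒳 × ℝ) := fun p =>
    {D | UnstableAt A e ε p.1 (Sum.inl p.1) D} ∪ {D | UnstableAt A e ε p.1 (Sum.inr p.2) D}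
  let B4 : Set (ι → 𝒳 × ℝ) := {D | κ ^ 2 * Fintype.card (Fin n × Fin m) <
    (Finset.univ.filter fun p => D ∈ W p).card}
  have hB1 : Q B1 ≤ ENNReal.ofReal δ := by
    have hsplit := measurePreserving_sumPiEquivProdPi (fun _ : ι => P)
    have h := measure_fresh_deviation_le (ι := Fin m) (iidLaw P n) P hE (by simpa using hm0) hs.le
    rw [Fintype.card_fin] at h
    refine le_trans ?_ (h.trans (ENNReal.ofReal_le_ofReal hsm))
    have h2 := hsplit.measure_preimage_equiv {w : (Fin n → 𝒳 × ℝ) × (Fin m → 𝒳 × ℝ) |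
      ((Finset.univ.filter fun j => (w.1, w.2 j) ∈ E).card : ℝ) + m * s ≤
        m * P.real {z | (w.1, z) ∈ E}}
    exact h2.le
  have hB2 : Q B2 ≤ ENNReal.ofReal δ := by
    have h := measure_equivariant_deviation_le P (fun D => strictTop (R D) t)
      (fun a => by
        have := measurableSet_setOf_finite_pattern (fun c => hRle (a, c))
          (fun q => ((Finset.univ.filter q).card : ℝ) ≤ t)
        simpa [strictTop] using this)
      (fun π D a => by
        simp only [strictTop, Finset.mem_filter, Finset.mem_univ, true_and, hRcomp]
        rw [Finset.card_equiv π (t := Finset.univ.filter fun c => R D (π a) ≤ R D c) (by simp)])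
      (Finset.univ.map Function.Embedding.inr) hs.le
    simp only [Finset.card_map, Finset.card_univ, Fintype.card_fin, hcardR] at h
    exact h.trans (ENNReal.ofReal_le_ofReal hsm)
  have hB3 : Q B3 ≤ ENNReal.ofReal δ := by
    have h := measure_equivariant_deviation_le P (fun D => weakBottom (R D) t)
      (fun a => by
        have := measurableSet_setOf_finite_pattern (fun c => hRlt (a, c))
          (fun q => t < ((Finset.univ.filter q).card : ℝ))
        simpa [weakBottom] using this)
      (fun π D a => by
        simp only [weakBottom, Finset.mem_filter, Finset.mem_univ, true_and, hRcomp]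
        rw [Finset.card_equiv π (t := Finset.univ.filter fun c => R D (π a) < R D c) (by simp)])
      (Finset.univ.map Function.Embedding.inl) hs.le
    simp only [Finset.card_map, Finset.card_univ, Fintype.card_fin, hcardR] at h
    exact h.trans (ENNReal.ofReal_le_ofReal hsn)
  have hν : 0 ≤ ν := by
    have := pow_nonneg hκ 3
    linarith
  have hB4 : Q B4 ≤ ENNReal.ofReal κ := by
    refine measure_many_occur_le Q W (fun p => (measurableSet_unstableAt A e ε _ _).union
      (measurableSet_unstableAt A e ε _ _)) hκ (by simp [hn0, hm0]) fun p => ?_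
    -- A pair is bad if either of two comparisons fails; their total `2 * ν` is exactly the `κ ^ 3`
    -- that Markov's inequality needs.
    rw [hκν, two_mul, ENNReal.ofReal_add hν hν]
    refine (measure_union_le _ _).trans (add_le_add ?_ ?_)
    · exact measure_unstableAt_le A P hstab he her _ _ (by simp [Fin.succAbove_ne])
    · exact measure_unstableAt_le A P hstab he her _ _ (by simp)
  have hsub : (fun D : ι → 𝒳 × ℝ => D ∘ Sum.inl) ⁻¹'
      {D | α + 3 * s + 2 * κ ≤ P.real {z | (D, z) ∈ E}} ⊆ (B1 ∪ B2) ∪ (B3 ∪ B4) := by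
    intro D hD
    by_contra hcon
    simp only [Set.mem_union, not_or] at hcon
    obtain ⟨⟨h1, h2⟩, h3, h4⟩ := hcon
    have hD' : α + 3 * s + 2 * κ ≤ P.real {z | (D ∘ Sum.inl, z) ∈ E} := hD
    have h1' : m * P.real {z | (D ∘ Sum.inl, z) ∈ E} <
        ((Finset.univ.filter fun j => (D ∘ Sum.inl, D (Sum.inr j)) ∈ E).card : ℝ) + m * s :=
      not_le.1 h1
    have h4' : ((Finset.univ.filter fun p => D ∈ W p).card : ℝ) ≤
        κ ^ 2 * Fintype.card (Fin n × Fin m) := not_lt.1 h4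
    have hcount := card_exceed_lt hn0 hm0 (R D) (looResidual A (D ∘ Sum.inl))
      (fun i j => |(D (Sum.inr j)).2 - looModel A (D ∘ Sum.inl) i (D (Sum.inr j)).1|)
      (fun i j => D ∈ W (i, j)) hα0 hα1 hκ hs has (not_le.1 h2) (not_le.1 h3)
      (ε := ε) (by simpa using h4') (by
        intro i j hij
        obtain ⟨hi, hj⟩ := not_or.1 hij
        have hi' := not_not.1 hi
        have hj' := not_not.1 hj
        constructor
        · refine (abs_sub_le _ (looModel A (D ∘ Sum.inl) i (D (Sum.inl i)).1) _).trans ?_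
          exact add_le_add le_rfl hi'
        · refine (abs_sub_le _ (A.fit _ (D ∘ e (Sum.inr j)) (D (Sum.inr j)).1) _).trans ?_
          rw [abs_sub_comm (A.fit _ _ _)]
          exact add_le_add le_rfl hj')
    have hcount' : ((Finset.univ.filter fun j => (D ∘ Sum.inl, D (Sum.inr j)) ∈ E).card : ℝ) <
        m * (α + 2 * κ + 2 * s) := by
      convert hcount using 3
      ext j
      simp only [Finset.mem_filter, Finset.mem_univ, true_and]
      exact Iff.rfl
    have hm' : (0 : ℝ) < m := by exact_mod_cast hm0
    -- The count is below `m * (α + 2 * κ + 2 * s)`, and failure of `B1` adds less than `m * s`,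
    -- contradicting `hD'`.
    nlinarith
  have hmeas : MeasurableSet {D | α + 3 * s + 2 * κ ≤ P.real {z | (D, z) ∈ E}} :=
    measurableSet_le measurable_const (measurable_measure_prodMk_left hE).ennreal_toReal
  have hpre := (measurePreserving_comp_of_injective P
    (Sum.inl_injective (α := Fin n) (β := Fin m))).measure_preimage hmeas.nullMeasurableSet
  change (Measure.pi fun _ : Fin n => P) _ ≤ _
  rw [← hpre]
  calc _ ≤ Q ((B1 ∪ B2) ∪ (B3 ∪ B4)) := measure_mono hsub
    _ ≤ (ENNReal.ofReal δ + ENNReal.ofReal δ) + (ENNReal.ofReal δ + ENNReal.ofReal κ) :=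
        (measure_union_le _ _).trans (add_le_add
          ((measure_union_le _ _).trans (add_le_add hB1 hB2))
          ((measure_union_le _ _).trans (add_le_add hB3 hB4)))
    _ = _ := by
        rw [← ENNReal.ofReal_add hδ hδ, ← ENNReal.ofReal_add hδ hκ,
          ← ENNReal.ofReal_add (by positivity) (by positivity)]
        congr 1; ring

end MainBound

/-! ### Conclusion -/

theorem theorem6 {𝒳 : Type*} [MeasurableSpace 𝒳]
    (P : Measure (𝒳 × ℝ)) [IsProbabilityMeasure P] (A : RegressionAlgorithm 𝒳)
    (n m : ℕ) (hn : 1 ≤ n) (hm : 1 ≤ m)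
    (α : ℝ) (hα0 : 0 ≤ α) (hα1 : α ≤ 1)
    (δ : ℝ) (hδ0 : 0 < δ) (hδ1 : δ < 1)
    (ε ν : ℝ)
    (hstab : ENNReal.ofReal (1 - ν) ≤ stabilityProb A P (n - 1) m ε) :
    ENNReal.ofReal (1 - 3 * δ - (2 * ν) ^ (1 / 3 : ℝ)) ≤
      iidLaw P n {D | miscoverage P (inflatedJackInterval A α (2 * ε) D) <
        ENNReal.ofReal (α + 3 * √(Real.log (1 / δ) / (2 * (min n m : ℝ)))
          + 2 * (2 * ν) ^ (1 / 3 : ℝ))} ∧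
    ∀ f : 𝒳 → ℝ → ℝ≥0∞, IsCondDensity P f →
      ENNReal.ofReal (1 - 3 * δ - (2 * ν) ^ (1 / 3 : ℝ)) ≤
        iidLaw P n {D | miscoverage P (jackInterval A α D) <
          ENNReal.ofReal (α + 3 * √(Real.log (1 / δ) / (2 * (min n m : ℝ)))
            + 2 * (2 * ν) ^ (1 / 3 : ℝ))
            + 4 * densBound P f * ENNReal.ofReal ε} := by
  have hν : 0 ≤ ν := by
    have h1 : ENNReal.ofReal (1 - ν) ≤ 1 := hstab.trans prob_le_one
    have h2 := ENNReal.ofReal_le_one.1 h1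
    linarith
  set κ := (2 * ν) ^ (1 / 3 : ℝ) with hκdef
  have hκ : 0 ≤ κ := Real.rpow_nonneg (by positivity) _
  have hκν : κ ^ 3 = 2 * ν := by
    rw [hκdef, ← Real.rpow_natCast, ← Real.rpow_mul (by positivity)]; norm_num
  set s := √(Real.log (1 / δ) / (2 * (min n m : ℝ))) with hsdef
  have hs : 0 < s := by
    have hl : 0 < Real.log (1 / δ) := Real.log_pos (by rw [lt_div_iff₀ hδ0]; linarith)
    have hmin : (0 : ℝ) < min (n : ℝ) m :=
      lt_min (by exact_mod_cast hn) (by exact_mod_cast hm)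
    exact Real.sqrt_pos.2 (by positivity)
  set c := α + 3 * s + 2 * κ with hc
  have hlarge : iidLaw P n {D | ENNReal.ofReal c ≤
      miscoverage P (inflatedJackInterval A α (2 * ε) D)} ≤ ENNReal.ofReal (3 * δ + κ) := by
    -- The rank threshold must not exceed `n + m`. Otherwise `c > 1`, and no miscoverage probability
    -- reaches it.
    by_cases has : α + κ + s ≤ 1
    · have hsM : ∀ M : ℕ, min n m ≤ M → Real.exp (-2 * M * s ^ 2) ≤ δ := by
        intro M hM
        have h := exp_neg_two_mul_sq_le hδ0 hδ1 (lt_min hn hm) hM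
        rwa [Nat.cast_min] at h
      have hn1 := hsM n (min_le_left _ _)
      have hm1 := hsM m (min_le_right _ _)
      obtain ⟨k, rfl⟩ : ∃ k, n = k + 1 := ⟨n - 1, by omega⟩
      obtain ⟨l, rfl⟩ : ∃ l, m = l + 1 := ⟨m - 1, by omega⟩
      refine le_trans (measure_mono fun D hD => ?_) (measure_exceedSet_large_le A P hα0 hα1
        hδ0.le hκ hκν hs hn1 hm1 has hstab)
      have hD' : ENNReal.ofReal c ≤ miscoverage P (inflatedJackInterval A α (2 * ε) D) := hD
      have h1 : miscoverage P (inflatedJackInterval A α (2 * ε) D) ≤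
          P {z | (D, z) ∈ exceedSet A (k + 1) α (2 * ε)} :=
        measure_mono fun z hz => mem_exceedSet_of_notMem A (Nat.succ_pos k) hz
      exact (ENNReal.ofReal_le_iff_le_toReal (measure_ne_top _ _)).1 (hD'.trans h1)
    · refine le_of_eq_of_le (measure_mono_null (t := ∅) (fun D hD => ?_) measure_empty) zero_le
      have hD' : ENNReal.ofReal c ≤ miscoverage P (inflatedJackInterval A α (2 * ε) D) := hD
      have h1 := ENNReal.ofReal_le_one.1 (hD'.trans prob_le_one)
      exact absurd h1 (by rw [hc]; linarith)
  have hfirst : ENNReal.ofReal (1 - 3 * δ - κ) ≤ iidLaw P n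
      {D | miscoverage P (inflatedJackInterval A α (2 * ε) D) < ENNReal.ofReal c} := by
    have hcover : (1 : ℝ≥0∞) ≤ iidLaw P n
        {D | miscoverage P (inflatedJackInterval A α (2 * ε) D) < ENNReal.ofReal c} +
        ENNReal.ofReal (3 * δ + κ) := by
      rw [← measure_univ (μ := iidLaw P n)]
      refine (measure_mono fun D _ => ?_).trans
        ((measure_union_le _ _).trans (add_le_add le_rfl hlarge))
      exact lt_or_ge (miscoverage P (inflatedJackInterval A α (2 * ε) D)) (ENNReal.ofReal c)
    rw [sub_sub, ENNReal.ofReal_sub _ (by positivity), ENNReal.ofReal_one]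
    exact tsub_le_iff_right.2 hcover
  refine ⟨hfirst, fun f hf => hfirst.trans (measure_mono fun D hD => ?_)⟩
  have hD' : miscoverage P (inflatedJackInterval A α (2 * ε) D) < ENNReal.ofReal c := hD
  change miscoverage P (jackInterval A α D) < ENNReal.ofReal c + _
  -- An infinite density term cannot be added to a strict inequality, but then the bound is
  -- trivially strict.
  by_cases htop : 4 * densBound P f * ENNReal.ofReal ε = ⊤
  · rw [htop, add_top]
    exact measure_lt_top _ _
  · exact (miscoverage_jackInterval_le A P α ε D hf).trans_lt
      (ENNReal.add_lt_add_right htop hD')
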